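/- Let $C$ be a coassociative counital coalgebra over a field $\mathbb K$, with comultiplication $\Delta$ and counit $\varepsilon$, and let $C^*$ be its dual algebra, with product $(fg)(c)=\sum f(c_1)g(c_2)$. Call $C$ right (left) semiperfect if every indecomposable injective left (right) $C$-comodule is finite dimensional. Let $R=\mathrm{Rat}({}_{C^*}C^*)$ be the largest rational submodule of the left $C^*$-module $C^*$, i.e. the set of those $f\in C^*$ for which there are finitely many $c_i\in C$, $f_i\in C^*$ with $gf=\sum_i g(c_i)f_i$ for all $g\in C^*$; it is a (not necessarily unital) algebra. Let $R^0$ be its finite dual: the space of linear functionals on $R$ whose kernel contains a two-sided ideal of finite codimension, with the comultiplication $\delta(f)=\sum_j g_j\otimes h_j$ determined by $f(ab)=\sum_j g_j(a)h_j(b)$ for all $a,b\in R$, where $g_j,h_j\in R^0$. Let $\phi_l:C\to R^0$ be the canonical map, $\phi_l(c)(r)=r(c)$. **Theorem.** Suppose that $C$ is both left and right semiperfect. Then $C$ is left coreflexive, i.e. $\phi_l:C\to R^0$ is bijective. Moreover, $(R^0,\delta)$ has a counit $E$, and $\phi_l$ is an isomorphism of counital coalgebras from $(C,\Delta,\varepsilon)$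 to $(R^0,\delta,E)$. The counit is described as follows. The left $C$-comodule $C$ has a decomposition $C=\bigoplus_{j\in J}E(S_j)$ into subcomodules $E(S_j)\subseteq C$, each of which is an injective hull of a simple left comodule $S_j$; and for every such decomposition, if $e_j\in C^*$ denotes the functional that agrees with $\varepsilon$ on $E(S_j)$ and vanishes on $E(S_p)$ for all $p\ne j$, then $e_j\in R$ for all $j$, and for every $f\in R^0$ only finitely many $f(e_j)$ are nonzero and $E(f)=\sum_{j\in J}f(e_j)$. -/

import Mathlib

open scoped TensorProduct

universe u v

/-! ## Comodules over a counital coalgebra -/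

section Comodules

variable {K : Type*} [Field K]

/-- `ρ : M → C ⊗ M` is a (coassociative, counital) left `C`-comodule structure. -/
structure IsLeftCoaction {C M : Type*} [AddCommGroup C] [Module K C] [Coalgebra K C]
    [AddCommGroup M] [Module K M] (ρ : M →ₗ[K] C ⊗[K] M) : Prop where
  coassoc : (TensorProduct.assoc K C C M).toLinearMap ∘ₗ
      (Coalgebra.comul (R := K) (A := C)).rTensor M ∘ₗ ρ = ρ.lTensor C ∘ₗ ρ
  counit : (TensorProduct.lid K M).toLinearMap ∘ₗ
      (Coalgebra.counit (R := K) (A := C)).rTensor M ∘ₗ ρ = LinearMap.id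

/-- `ρ : M → M ⊗ C` is a (coassociative, counital) right `C`-comodule structure. -/
structure IsRightCoaction {C M : Type*} [AddCommGroup C] [Module K C] [Coalgebra K C]
    [AddCommGroup M] [Module K M] (ρ : M →ₗ[K] M ⊗[K] C) : Prop where
  coassoc : (TensorProduct.assoc K M C C).toLinearMap ∘ₗ ρ.rTensor C ∘ₗ ρ =
      (Coalgebra.comul (R := K) (A := C)).lTensor M ∘ₗ ρ
  counit : (TensorProduct.rid K M).toLinearMap ∘ₗ
      (Coalgebra.counit (R := K) (A := C)).lTensor M ∘ₗ ρ = LinearMap.id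

/-- `f` is a morphism of left comodules. -/
def IsLeftComoduleHom {C M N : Type*} [AddCommGroup C] [Module K C]
    [AddCommGroup M] [Module K M] [AddCommGroup N] [Module K N]
    (ρ : M →ₗ[K] C ⊗[K] M) (σ : N →ₗ[K] C ⊗[K] N) (f : M →ₗ[K] N) : Prop :=
  σ ∘ₗ f = f.lTensor C ∘ₗ ρ

/-- `f` is a morphism of right comodules. -/
def IsRightComoduleHom {C M N : Type*} [AddCommGroup C] [Module K C]
    [AddCommGroup M] [Module K M] [AddCommGroup N] [Module K N]
    (ρ : M →ₗ[K] M ⊗[K] C) (σ : N →ₗ[K] N ⊗[K] C) (f : M →ₗ[K] N) : Prop :=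
  σ ∘ₗ f = f.rTensor C ∘ₗ ρ

/-- `N` is a subcomodule of the left comodule `(M, ρ)`: `ρ(N) ⊆ C ⊗ N`. -/
def IsLeftSubcomodule {C M : Type*} [AddCommGroup C] [Module K C]
    [AddCommGroup M] [Module K M] (ρ : M →ₗ[K] C ⊗[K] M) (N : Submodule K M) : Prop :=
  ∀ x ∈ N, ρ x ∈ LinearMap.range (N.subtype.lTensor C)

/-- `N` is a subcomodule of the right comodule `(M, ρ)`: `ρ(N) ⊆ N ⊗ C`. -/
def IsRightSubcomodule {C M : Type*} [AddCommGroup C] [Module K C]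
    [AddCommGroup M] [Module K M] (ρ : M →ₗ[K] M ⊗[K] C) (N : Submodule K M) : Prop :=
  ∀ x ∈ N, ρ x ∈ LinearMap.range (N.subtype.rTensor C)

/-- The coaction of a left subcomodule `N` of `(M, ρ)`. -/
noncomputable def leftRestrict {C M : Type*} [AddCommGroup C] [Module K C]
    [AddCommGroup M] [Module K M] (ρ : M →ₗ[K] C ⊗[K] M) (N : Submodule K M)
    (hN : IsLeftSubcomodule ρ N) : N →ₗ[K] C ⊗[K] N :=
  (LinearEquiv.ofInjective (N.subtype.lTensor C)
      (Module.Flat.lTensor_preserves_injective_linearMap _ N.injective_subtype)).symm.toLinearMap ∘ₗ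
    (ρ ∘ₗ N.subtype).codRestrict _ (fun x => hN x x.2)

theorem lTensor_comp_leftRestrict {C M : Type*} [AddCommGroup C] [Module K C]
    [AddCommGroup M] [Module K M] (ρ : M →ₗ[K] C ⊗[K] M) (N : Submodule K M)
    (hN : IsLeftSubcomodule ρ N) :
    N.subtype.lTensor C ∘ₗ leftRestrict ρ N hN = ρ ∘ₗ N.subtype := by
  ext x
  have := LinearEquiv.apply_symm_apply (LinearEquiv.ofInjective (N.subtype.lTensor C)
      (Module.Flat.lTensor_preserves_injective_linearMap _ N.injective_subtype))
      ((ρ ∘ₗ N.subtype).codRestrict _ (fun x => hN x x.2) x)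
  exact congrArg Subtype.val this

/-- The left comodule `(M, ρ)` is nonzero and is not a direct sum of two nonzero subcomodules. -/
def IsLeftIndecomposable {C M : Type*} [AddCommGroup C] [Module K C]
    [AddCommGroup M] [Module K M] (ρ : M →ₗ[K] C ⊗[K] M) : Prop :=
  Nontrivial M ∧ ∀ N P : Submodule K M, IsLeftSubcomodule ρ N → IsLeftSubcomodule ρ P →
    IsCompl N P → N = ⊥ ∨ P = ⊥

/-- The right comodule `(M, ρ)` is nonzero and is not a direct sum of two nonzero subcomodules. -/
def IsRightIndecomposable {C M : Type*} [AddCommGroup C] [Module K C]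
    [AddCommGroup M] [Module K M] (ρ : M →ₗ[K] M ⊗[K] C) : Prop :=
  Nontrivial M ∧ ∀ N P : Submodule K M, IsRightSubcomodule ρ N → IsRightSubcomodule ρ P →
    IsCompl N P → N = ⊥ ∨ P = ⊥

end Comodules

section Injective

variable {K : Type u} [Field K] {C : Type v} [AddCommGroup C] [Module K C] [Coalgebra K C]

/-- `(M, ρ)` is an injective object of the category of left `C`-comodules. -/
def IsLeftInjective {M : Type v} [AddCommGroup M] [Module K M] (ρ : M →ₗ[K] C ⊗[K] M) : Prop :=
  ∀ (X Y : Type v) [AddCommGroup X] [Module K X] [AddCommGroup Y] [Module K Y]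
    (ρX : X →ₗ[K] C ⊗[K] X) (ρY : Y →ₗ[K] C ⊗[K] Y), IsLeftCoaction ρX → IsLeftCoaction ρY →
    ∀ (i : X →ₗ[K] Y) (f : X →ₗ[K] M), IsLeftComoduleHom ρX ρY i → Function.Injective i →
      IsLeftComoduleHom ρX ρ f → ∃ g : Y →ₗ[K] M, IsLeftComoduleHom ρY ρ g ∧ g ∘ₗ i = f

/-- `(M, ρ)` is an injective object of the category of right `C`-comodules. -/
def IsRightInjective {M : Type v} [AddCommGroup M] [Module K M] (ρ : M →ₗ[K] M ⊗[K] C) : Prop :=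
  ∀ (X Y : Type v) [AddCommGroup X] [Module K X] [AddCommGroup Y] [Module K Y]
    (ρX : X →ₗ[K] X ⊗[K] C) (ρY : Y →ₗ[K] Y ⊗[K] C), IsRightCoaction ρX → IsRightCoaction ρY →
    ∀ (i : X →ₗ[K] Y) (f : X →ₗ[K] M), IsRightComoduleHom ρX ρY i → Function.Injective i →
      IsRightComoduleHom ρX ρ f → ∃ g : Y →ₗ[K] M, IsRightComoduleHom ρY ρ g ∧ g ∘ₗ i = f

/-- The left comodule `(M, ρ)` is an injective hull of a simple comodule: it is injective and has
a simple essential subcomodule `S`. -/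
def IsInjectiveHullOfLeftSimple {M : Type v} [AddCommGroup M] [Module K M]
    (ρ : M →ₗ[K] C ⊗[K] M) : Prop :=
  IsLeftInjective ρ ∧ ∃ S : Submodule K M,
    (IsLeftSubcomodule ρ S ∧ S ≠ ⊥ ∧
      ∀ N : Submodule K M, IsLeftSubcomodule ρ N → N ≤ S → N = ⊥ ∨ N = S) ∧
    ∀ N : Submodule K M, IsLeftSubcomodule ρ N → N ≠ ⊥ → N ⊓ S ≠ ⊥

variable (K C)

/-- `C` is left semiperfect: the indecomposable injective right `C`-comodules are
finite dimensional. -/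
def IsLeftSemiperfect : Prop :=
  ∀ (M : Type v) [AddCommGroup M] [Module K M] (ρ : M →ₗ[K] M ⊗[K] C), IsRightCoaction ρ →
    IsRightInjective ρ → IsRightIndecomposable ρ → FiniteDimensional K M

/-- `C` is right semiperfect: the indecomposable injective left `C`-comodules are
finite dimensional. -/
def IsRightSemiperfect : Prop :=
  ∀ (M : Type v) [AddCommGroup M] [Module K M] (ρ : M →ₗ[K] C ⊗[K] M), IsLeftCoaction ρ →
    IsLeftInjective ρ → IsLeftIndecomposable ρ → FiniteDimensional K M

variable {K C}

/-- A decomposition `C = ⨁ⱼ E(Sⱼ)` of the left comodule `C`, where each `E(Sⱼ) ⊆ C` is an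
injective hull of a simple left comodule `Sⱼ`. -/
structure IsLeftInjectiveDecomposition {J : Type*} (E : J → Submodule K C) : Prop where
  subcomodule : ∀ j, IsLeftSubcomodule (Coalgebra.comul (R := K) (A := C)) (E j)
  indep : iSupIndep E
  iSup_eq_top : ⨆ j, E j = ⊤
  hull : ∀ j, IsInjectiveHullOfLeftSimple (leftRestrict Coalgebra.comul (E j) (subcomodule j))

theorem IsLeftInjectiveDecomposition.isCompl {J : Type*} {E : J → Submodule K C}
    (h : IsLeftInjectiveDecomposition E) (j : J) : IsCompl (E j) (⨆ (p) (_ : p ≠ j), E p) := by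
  refine ⟨h.indep j, codisjoint_iff.2 (top_le_iff.1 ?_)⟩
  rw [← h.iSup_eq_top]
  refine iSup_le fun p => ?_
  by_cases hp : p = j
  · subst hp; exact le_sup_left
  · exact le_sup_of_le_right (le_iSup₂_of_le p hp le_rfl)

end Injective

/-! ## The dual algebra and its left rational part -/

section Rational

variable (K : Type*) [Field K] (C : Type*) [AddCommGroup C] [Module K C] [Coalgebra K C]

/-- The dual algebra `C^*`, with the convolution product `(f * g)(c) = ∑ f(c₁) g(c₂)` and with
unit the counit of `C`. -/
abbrev DualAlgebra : Type _ := WithConv (C →ₗ[K] K)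

/-- For a decomposition `C = ⨁ⱼ Eⱼ`, the functional `eⱼ` that agrees with the counit on `Eⱼ` and
vanishes on `E_p` for `p ≠ j`. -/
noncomputable def IsLeftInjectiveDecomposition.idem {K : Type*} [Field K] {C : Type*}
    [AddCommGroup C] [Module K C] [Coalgebra K C] {J : Type*} {E : J → Submodule K C}
    (h : IsLeftInjectiveDecomposition E) (j : J) : DualAlgebra K C :=
  WithConv.toConv (Coalgebra.counit ∘ₗ (E j).subtype ∘ₗ
    (E j).projectionOnto (⨆ (p) (_ : p ≠ j), E p) (h.isCompl j))

/-- `Rat(_{C^*} C^*)`, the largest rational submodule of the left `C^*`-module `C^*`: the elements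
`f` for which there are finite families `cᵢ` in `C` and `fᵢ` in `C^*` such that
`g * f = ∑ g(cᵢ) fᵢ` for all `g` in `C^*`. It is a (non-unital) subalgebra of `C^*`. -/
def leftRat : NonUnitalSubalgebra K (DualAlgebra K C) where
  carrier := {f | ∃ (n : ℕ) (c : Fin n → C) (m : Fin n → DualAlgebra K C),
    ∀ g : DualAlgebra K C, g * f = ∑ i, g (c i) • m i}
  zero_mem' := ⟨0, Fin.elim0, Fin.elim0, fun g => by simp⟩
  add_mem' := by
    rintro f f' ⟨n, c, m, h⟩ ⟨n', c', m', h'⟩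
    refine ⟨n + n', Fin.append c c', Fin.append m m', fun g => ?_⟩
    rw [mul_add, h, h', Fin.sum_univ_add]
    simp
  mul_mem' := by
    rintro f f' ⟨n, c, m, h⟩ -
    exact ⟨n, c, fun i => m i * f', fun g => by
      rw [← mul_assoc, h, Finset.sum_mul]
      simp only [smul_mul_assoc]⟩
  smul_mem' := by
    rintro a f ⟨n, c, m, h⟩
    exact ⟨n, c, fun i => a • m i, fun g => by
      rw [mul_smul_comm, h, Finset.smul_sum]
      exact Finset.sum_congr rfl fun i _ => smul_comm _ _ _⟩

end Rational

/-! ## The finite dual of a not necessarily unital algebra -/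

section FiniteDual

variable (K : Type*) [Field K] (A : Type*) [NonUnitalRing A] [Module K A]

variable {K A} in
/-- `I` is a two-sided ideal of finite codimension of the algebra `A`. -/
structure IsCofiniteIdeal (I : Submodule K A) : Prop where
  mul_left : ∀ a x : A, x ∈ I → a * x ∈ I
  mul_right : ∀ a x : A, x ∈ I → x * a ∈ I
  finite : FiniteDimensional K (A ⧸ I)

theorem finiteDimensional_quotient_of_ker_le {ι : Type*} [Finite ι] (Ψ : A →ₗ[K] (ι → K))
    {I : Submodule K A} (h : LinearMap.ker Ψ ≤ I) : FiniteDimensional K (A ⧸ I) := by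
  have : Module.Finite K (A ⧸ LinearMap.ker Ψ) :=
    Module.Finite.equiv Ψ.quotKerEquivRange.symm
  exact Module.Finite.of_surjective (Submodule.factor h) (Submodule.factor_surjective h)

/-- The finite dual `A^0`: the functionals whose kernel contains a two-sided ideal of finite
codimension. -/
def finiteDual : Submodule K (Module.Dual K A) where
  carrier := {f | ∃ I : Submodule K A, IsCofiniteIdeal I ∧ I ≤ LinearMap.ker f}
  zero_mem' := ⟨⊤, ⟨fun _ _ _ => trivial, fun _ _ _ => trivial, inferInstance⟩, by simp⟩
  add_mem' := by
    rintro f g ⟨I, hI, hIf⟩ ⟨J, hJ, hJg⟩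
    refine ⟨I ⊓ J, ⟨fun a x hx => ⟨hI.1 a x hx.1, hJ.1 a x hx.2⟩,
      fun a x hx => ⟨hI.2 a x hx.1, hJ.2 a x hx.2⟩, ?_⟩, fun x hx => ?_⟩
    · have := hI.finite
      have := hJ.finite
      have hk : LinearMap.ker (I.mkQ.prod J.mkQ) = I ⊓ J := by
        rw [LinearMap.ker_prod, Submodule.ker_mkQ, Submodule.ker_mkQ]
      rw [← hk]
      exact Module.Finite.equiv (I.mkQ.prod J.mkQ).quotKerEquivRange.symm
    · have h1 : f x = 0 := hIf hx.1
      have h2 : g x = 0 := hJg hx.2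
      simp [h1, h2]
  smul_mem' := by
    rintro a f ⟨I, hI, hIf⟩
    refine ⟨I, hI, fun x hx => ?_⟩
    have h1 : f x = 0 := hIf hx
    simp [h1]

variable {K A} in
/-- For a space `D` of functions on `A`, embedded by `ι`, the map `D ⊗ D → (A × A → K)` with
`g ⊗ h ↦ ((a, b) ↦ g(a) h(b))`. -/
noncomputable def tensorPairing {A D : Type*} [AddCommMonoid D] [Module K D]
    (ι : D →ₗ[K] (A → K)) : D ⊗[K] D →ₗ[K] (A → A → K) :=
  TensorProduct.lift (LinearMap.mk₂ K (fun g h a b => ι g a * ι h b)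
    (fun _ _ _ => by ext; simp [add_mul]) (fun _ _ _ => by ext; simp [mul_assoc])
    (fun _ _ _ => by ext; simp [mul_add]) (fun _ _ _ => by ext; simp [mul_left_comm]))

variable {K A} in
theorem tensorPairing_injective {A D : Type*} [AddCommGroup D] [Module K D]
    (ι : D →ₗ[K] (A → K)) (hι : Function.Injective ι) :
    Function.Injective (tensorPairing ι) := by
  rw [injective_iff_map_eq_zero]
  intro t ht
  set B := Module.Free.chooseBasis K D
  obtain ⟨s, rfl⟩ := (TensorProduct.equivFinsuppOfBasisRight (M := D) B).symm.surjective t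
  have hs : s = 0 := by
    ext i
    apply hι
    ext a
    have hlin : ∑ i ∈ s.support, ι (s i) a • B i = 0 := by
      apply hι
      ext b
      have := congrFun (congrFun ht a) b
      simpa [TensorProduct.equivFinsuppOfBasisRight_symm_apply, Finsupp.sum, map_sum,
        Finset.sum_apply, tensorPairing] using this
    by_cases hi : i ∈ s.support
    · simpa using linearIndependent_iff'.1 B.linearIndependent _ _ hlin i hi
    · rw [Finsupp.notMem_support_iff.1 hi]; rfl
  rw [hs, map_zero]

/-- The map `A^0 ⊗ A^0 → (A × A → K)` with `g ⊗ h ↦ ((a, b) ↦ g(a) h(b))`. -/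
noncomputable def finiteDualPairing :
    finiteDual K A ⊗[K] finiteDual K A →ₗ[K] (A → A → K) :=
  tensorPairing
    { toFun := fun f => f.1
      map_add' := fun _ _ => rfl
      map_smul' := fun _ _ => rfl }

@[simp]
theorem finiteDualPairing_tmul (g h : finiteDual K A) (a b : A) :
    finiteDualPairing K A (g ⊗ₜ h) a b = g.1 a * h.1 b := rfl

theorem finiteDualPairing_injective : Function.Injective (finiteDualPairing K A) :=
  tensorPairing_injective (D := finiteDual K A) _
    (fun _ _ h => Subtype.ext (DFunLike.coe_injective h))

variable [SMulCommClass K A A] [IsScalarTower K A A]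

/-- The map `f ↦ ((a, b) ↦ f(ab))`. -/
def finiteDualMul : finiteDual K A →ₗ[K] (A → A → K) where
  toFun f a b := f.1 (a * b)
  map_add' _ _ := rfl
  map_smul' _ _ := rfl

theorem finiteDualMul_mem_range (f : finiteDual K A) :
    finiteDualMul K A f ∈ LinearMap.range (finiteDualPairing K A) := by
  obtain ⟨f, I, hI, hf⟩ := f
  have := hI.finite
  let B := Module.finBasis K (A ⧸ I)
  choose v hv using fun i => I.mkQ_surjective (B i)
  let g : Fin _ → finiteDual K A := fun i => ⟨f ∘ₗ LinearMap.mulRight K (v i),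
    I, hI, fun x hx => hf (hI.mul_right (v i) x hx)⟩
  let h : Fin _ → finiteDual K A := fun i => ⟨B.coord i ∘ₗ I.mkQ,
    I, hI, fun x hx => by
      have : I.mkQ x = 0 := by simpa using hx
      rw [LinearMap.mem_ker, LinearMap.comp_apply, this, map_zero]⟩
  refine ⟨∑ i, g i ⊗ₜ h i, ?_⟩
  ext a b
  have hb : b - ∑ i, B.coord i (I.mkQ b) • v i ∈ I := by
    rw [← Submodule.Quotient.mk_eq_zero, ← Submodule.mkQ_apply, map_sub, map_sum, sub_eq_zero]
    simp only [map_smul, hv]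
    exact (B.sum_repr _).symm
  have h0 : f (a * (b - ∑ i, B.coord i (I.mkQ b) • v i)) = 0 := hf (hI.mul_left a _ hb)
  rw [mul_sub, map_sub, sub_eq_zero] at h0
  change _ = f (a * b)
  rw [h0, Finset.mul_sum]
  simp only [map_sum, Finset.sum_apply, finiteDualPairing_tmul, mul_smul_comm, map_smul]
  exact Finset.sum_congr rfl fun i _ => mul_comm _ _

/-- The comultiplication `δ : A^0 → A^0 ⊗ A^0` of the finite dual: `δ(f)` is the unique
`∑ gⱼ ⊗ hⱼ` with `f(ab) = ∑ gⱼ(a) hⱼ(b)` for all `a`, `b`. -/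
noncomputable def finiteDualComul : finiteDual K A →ₗ[K] finiteDual K A ⊗[K] finiteDual K A :=
  (LinearEquiv.ofInjective _ (finiteDualPairing_injective K A)).symm.toLinearMap ∘ₗ
    (finiteDualMul K A).codRestrict _ (finiteDualMul_mem_range K A)

theorem finiteDualPairing_comul (f : finiteDual K A) (a b : A) :
    finiteDualPairing K A (finiteDualComul K A f) a b = f.1 (a * b) := by
  have := LinearEquiv.apply_symm_apply
    (LinearEquiv.ofInjective _ (finiteDualPairing_injective K A))
    ((finiteDualMul K A).codRestrict _ (finiteDualMul_mem_range K A) f)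
  exact congrFun (congrFun (congrArg Subtype.val this) a) b

end FiniteDual

/-! ## Left coreflexive coalgebras -/

section Coreflexive

variable (K : Type*) [Field K] (C : Type*) [AddCommGroup C] [Module K C] [Coalgebra K C]

/-- Evaluation at an element of `C`, as a map from `C` to the functionals on
`R = Rat(_{C^*} C^*)`. -/
noncomputable def evalRat : C →ₗ[K] Module.Dual K (leftRat K C) where
  toFun c :=
    { toFun := fun r => r.1 c
      map_add' := fun _ _ => rfl
      map_smul' := fun _ _ => rfl }
  map_add' c d := by ext r; exact map_add r.1.ofConv c d
  map_smul' a c := by ext r; exact map_smul r.1.ofConv a c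

theorem evalRat_mem_finiteDual (c : C) : evalRat K C c ∈ finiteDual K (leftRat K C) := by
  classical
  let I : Submodule K (leftRat K C) :=
    { carrier := {r | ∀ a b : DualAlgebra K C, (a * r.1 * b) c = 0}
      zero_mem' := fun a b => by simp
      add_mem' := fun {r s} hr hs a b => by
        have : a * (r + s).1 * b = a * r.1 * b + a * s.1 * b := by
          change a * (r.1 + s.1) * b = _
          rw [mul_add, add_mul]
        rw [this, WithConv.ofConv_add, LinearMap.add_apply, hr a b, hs a b, add_zero]
      smul_mem' := fun k r hr a b => by
        have : a * (k • r).1 * b = k • (a * r.1 * b) := by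
          change a * (k • r.1) * b = _
          rw [mul_smul_comm, smul_mul_assoc]
        rw [this, WithConv.ofConv_smul, LinearMap.smul_apply, hr a b, smul_zero] }
  refine ⟨I, ⟨fun s r hr a b => ?_, fun s r hr a b => ?_, ?_⟩, fun r hr => ?_⟩
  · change (a * (s.1 * r.1) * b) c = 0
    rw [← mul_assoc]
    exact hr (a * s.1) b
  · change (a * (r.1 * s.1) * b) c = 0
    rw [← mul_assoc, mul_assoc]
    exact hr a (s.1 * b)
  · let P := Coalgebra.Repr.arbitrary K c
    let Q := fun i => Coalgebra.Repr.arbitrary K (P.left i)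
    let S : Finset C := P.index.biUnion fun i => (Q i).index.image (Q i).right
    let Ψ : leftRat K C →ₗ[K] (S → K) :=
      { toFun := fun r y => r.1 y.1
        map_add' := fun _ _ => rfl
        map_smul' := fun _ _ => rfl }
    have hΨ : LinearMap.ker Ψ ≤ I := fun r hr a b => by
      rw [P.convMul_apply]
      refine Finset.sum_eq_zero fun i hi => ?_
      rw [(Q i).convMul_apply, Finset.sum_eq_zero, zero_mul]
      intro k hk
      have : r.1 ((Q i).right k) = 0 := congrFun (LinearMap.mem_ker.1 hr)
        ⟨_, Finset.mem_biUnion.2 ⟨i, hi, Finset.mem_image_of_mem _ hk⟩⟩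
      rw [this, mul_zero]
    exact finiteDimensional_quotient_of_ker_le K (leftRat K C) Ψ hΨ
  · have := hr 1 1
    rwa [one_mul, mul_one] at this

/-- The canonical map `φ_l : C → (Rat(_{C^*} C^*))^0`, `φ_l(c)(r) = r(c)`. -/
noncomputable def phiLeft : C →ₗ[K] finiteDual K (leftRat K C) :=
  (evalRat K C).codRestrict _ (evalRat_mem_finiteDual K C)

/-- `C` is left coreflexive: `φ_l` is bijective. -/
def IsLeftCoreflexive : Prop := Function.Bijective (phiLeft K C)

end Coreflexive

/-! ## Injective hulls inside a quasi-injective module -/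

/-! Comodule maps M → C correspond to functionals on M, so C is an injective left comodule. Left
subcomodules of C are the invariant subspaces of the operators c ↦ ∑ f(c₁) c₂. Over the algebra they
generate, C is therefore a quasi-injective module, and its cyclic submodules are finite dimensional.
Module theory then splits C into hulls E_j of simple submodules
(`exists_isLeftInjectiveDecomposition`).

Since Δ(E_j) ⊆ C ⊗ E_j, right multiplication by e_j is composition with the projection onto E_j
(`mul_idem`). So the e_j are orthogonal idempotents and C^* e_j is E_j^*. Right semiperfectness
makes E_j finite dimensional, which puts e_j, hence C^* e_j, inside R. These functionals separate
the points of C, so φ_l is injective.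

For surjectivity, let f ∈ R^0 vanish on a cofinite ideal I. On C^* e_j = E_j^*, f is evaluation at
some c_j ∈ E_j. Orthogonal idempotents outside I are independent modulo I, so almost all e_j lie in
I and almost all c_j vanish. Left semiperfectness shows that every r ∈ R is a finite sum of the r
e_j (`exists_mul_sum_idem`), whence f is evaluation at ∑ c_j.

The comultiplications match because the product of C^* is dual to Δ. The counit is carried over
along φ_l: if f = φ_l(c), then E(f) = ε(c) = ∑ ε(proj_j c) = ∑ f(e_j). -/

section QuasiInjective

variable {A M : Type*} [Ring A] [AddCommGroup M] [Module A M]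

/-- Every homomorphism from a submodule of `M` to `M` extends to an endomorphism of `M`. -/
def IsQuasiInjective (A M : Type*) [Ring A] [AddCommGroup M] [Module A M] : Prop :=
  ∀ (N : Submodule A M) (f : N →ₗ[A] M), ∃ g : M →ₗ[A] M, ∀ x : N, g x = f x

/-- `N` is a retract, that is a direct summand, of `M`. -/
def Submodule.IsRetract (N : Submodule A M) : Prop :=
  ∃ g : M →ₗ[A] M, (∀ x, g x ∈ N) ∧ ∀ x ∈ N, g x = x

/-- `E` is a direct summand of `M` that is an essential extension of a simple submodule. -/
def Submodule.IsSimpleHull (E : Submodule A M) : Prop :=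
  E.IsRetract ∧ ∃ S ≤ E, IsAtom S ∧ ∀ N ≤ E, N ≠ ⊥ → S ≤ N

theorem IsQuasiInjective.exists_extend_projection (hq : IsQuasiInjective A M)
    {N P : Submodule A M} (h : Disjoint N P) :
    ∃ g : M →ₗ[A] M, (∀ x ∈ N, g x = x) ∧ ∀ x ∈ P, g x = 0 := by
  let s : N × P →ₗ[A] M := N.subtype.coprod P.subtype
  have hs : Function.Injective s := by
    rw [← LinearMap.ker_eq_bot, LinearMap.ker_eq_bot']
    rintro ⟨x, y⟩ hxy
    have hxy' : (x : M) + y = 0 := by simpa [s] using hxy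
    have hx : (x : M) = 0 := Submodule.disjoint_def.1 h x x.2 (by
      rw [eq_neg_of_add_eq_zero_left hxy']; exact P.neg_mem y.2)
    have hy : (y : M) = 0 := by rwa [hx, zero_add] at hxy'
    exact Prod.ext (Subtype.ext hx) (Subtype.ext hy)
  let e := LinearEquiv.ofInjective s hs
  obtain ⟨g, hg⟩ := hq (LinearMap.range s) (N.subtype ∘ₗ LinearMap.fst A N P ∘ₗ e.symm.toLinearMap)
  have key : ∀ z, g (s z) = z.1 := fun z => by
    have h1 := hg (e z)
    simp only [LinearMap.comp_apply, LinearEquiv.coe_coe, LinearEquiv.symm_apply_apply] at h1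
    exact h1
  refine ⟨g, fun x hx => ?_, fun x hx => ?_⟩
  · simpa [s] using key (⟨x, hx⟩, 0)
  · simpa [s] using key (0, ⟨x, hx⟩)

theorem Submodule.isRetract_bot : (⊥ : Submodule A M).IsRetract :=
  ⟨0, fun _ => Submodule.zero_mem _, fun x hx => by simpa using ((Submodule.mem_bot A).1 hx).symm⟩

/-- The extended projections of N ⊕ P need not take values in N and P on all of M; composing them
with the given retractions repairs this. -/
theorem Submodule.IsRetract.sup (hq : IsQuasiInjective A M) {N P : Submodule A M}
    (hN : N.IsRetract) (hP : P.IsRetract) (h : Disjoint N P) : (N ⊔ P).IsRetract := by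
  obtain ⟨f, hf, hfN⟩ := hN
  obtain ⟨g, hg, hgP⟩ := hP
  obtain ⟨a, haN, haP⟩ := hq.exists_extend_projection h
  obtain ⟨b, hbP, hbN⟩ := hq.exists_extend_projection h.symm
  refine ⟨f ∘ₗ a + g ∘ₗ b, fun x => Submodule.add_mem_sup (hf _) (hg _), fun x hx => ?_⟩
  obtain ⟨y, hy, z, hz, rfl⟩ := Submodule.mem_sup.1 hx
  simp [haN y hy, haP z hz, hbN y hy, hbP z hz, hfN y hy, hgP z hz]

theorem Submodule.IsRetract.finset_sup (hq : IsQuasiInjective A M) {𝒮 : Set (Submodule A M)}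
    (hi : sSupIndep 𝒮) (h𝒮 : ∀ E ∈ 𝒮, E.IsRetract) (t : Finset (Submodule A M)) (ht : ↑t ⊆ 𝒮) :
    (t.sup id).IsRetract := by
  classical
  induction t using Finset.induction_on with
  | empty => exact Submodule.isRetract_bot
  | insert E t hE ih =>
    rw [Finset.coe_insert, Set.insert_subset_iff] at ht
    rw [Finset.sup_insert]
    refine (h𝒮 E ht.1).sup hq (ih ht.2) ?_
    rw [Finset.sup_id_eq_sSup]
    exact hi.disjoint_sSup ht.1 ht.2 (by simpa using hE)

theorem Submodule.IsRetract.exists_isCompl {N : Submodule A M} (h : N.IsRetract) :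
    ∃ P, IsCompl N P := by
  obtain ⟨g, hg, hgN⟩ := h
  refine ⟨LinearMap.ker g, ?_, ?_⟩
  · rw [Submodule.disjoint_def]
    intro x hx hx'
    rw [← hgN x hx, LinearMap.mem_ker.1 hx']
  · rw [codisjoint_iff, Submodule.eq_top_iff']
    intro x
    refine Submodule.mem_sup.2 ⟨g x, hg x, x - g x, ?_, by abel⟩
    rw [LinearMap.mem_ker, map_sub, hgN _ (hg x), sub_self]

theorem Submodule.exists_maximal_disjoint {N P : Submodule A M} (h : Disjoint N P) :
    ∃ Q, N ≤ Q ∧ Disjoint Q P ∧ ∀ R, Q ≤ R → Disjoint R P → R = Q := by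
  obtain ⟨Q, hNQ, hQ⟩ := zorn_le_nonempty₀ {Q : Submodule A M | Disjoint Q P} (by
    intro c hc hchain y hy
    refine ⟨sSup c, ?_, fun z hz => le_sSup hz⟩
    exact hchain.directedOn.disjoint_sSup_left.2 fun b hb => hc hb) N h
  exact ⟨Q, hNQ, hQ.prop, fun R hQR hR => le_antisymm (hQ.2 hR hQR) hQR⟩

/-- Take P maximal disjoint from S, then E ⊇ S maximal disjoint from P. Extend the projection E ⊕ P
→ E to an endomorphism g. Maximality of P forces ker g = P = g⁻¹(P), so the image of g misses P, and
maximality of E makes it E. -/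
theorem IsQuasiInjective.exists_isSimpleHull (hq : IsQuasiInjective A M) {S : Submodule A M}
    (hS : IsAtom S) : ∃ E : Submodule A M, S ≤ E ∧ E.IsRetract ∧ ∀ N ≤ E, N ≠ ⊥ → S ≤ N := by
  obtain ⟨P, -, hPS, hPmax⟩ := Submodule.exists_maximal_disjoint (disjoint_bot_left (a := S))
  obtain ⟨E, hSE, hEP, hEmax⟩ := Submodule.exists_maximal_disjoint hPS.symm
  refine ⟨E, hSE, ?_, fun N hN hN0 => ?_⟩
  · obtain ⟨g, hgE, hgP⟩ := hq.exists_extend_projection hEP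
    have hker : LinearMap.ker g = P := hPmax _ (fun x hx => hgP x hx) (by
      rw [Submodule.disjoint_def]
      intro x hx hxS
      rw [← hgE x (hSE hxS), LinearMap.mem_ker.1 hx])
    have hcomap : P.comap g = P := hPmax _ (fun x hx => by simp [hgP x hx]) (by
      rw [Submodule.disjoint_def]
      intro x hx hxS
      rw [Submodule.mem_comap, hgE x (hSE hxS)] at hx
      exact Submodule.disjoint_def.1 hPS x hx hxS)
    have hrange : LinearMap.range g = E := hEmax _ (fun x hx => ⟨x, hgE x hx⟩) (by
      rw [Submodule.disjoint_def]
      rintro _ ⟨y, rfl⟩ hy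
      have : y ∈ P.comap g := hy
      rw [hcomap] at this
      exact hgP y this)
    exact ⟨g, fun x => hrange ▸ LinearMap.mem_range_self g x, hgE⟩
  · rw [← hS.not_disjoint_iff_le]
    intro hd
    apply hN0
    -- If n + p ∈ S, then p ∈ E ∩ P = 0. Maximality of P now gives N ≤ P, against N ≤ E.
    have hNP : Disjoint (N ⊔ P) S := by
      rw [Submodule.disjoint_def]
      intro x hx hxS
      obtain ⟨n, hn, p, hp, rfl⟩ := Submodule.mem_sup.1 hx
      have hpE : p ∈ E := by
        simpa using E.sub_mem (hSE hxS) (hN hn)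
      have hp0 : p = 0 := Submodule.disjoint_def.1 hEP p hpE hp
      subst hp0
      rw [add_zero] at hxS ⊢
      exact Submodule.disjoint_def.1 hd n hxS hn
    have h1 : N ≤ P := by
      rw [← hPmax _ le_sup_right hNP]; exact le_sup_left
    exact eq_bot_iff.2 (hEP hN h1)

theorem sSupIndep_insert {α : Type*} [CompleteLattice α] [IsModularLattice α] {s : Set α} {a : α}
    (hs : sSupIndep s) (ha : Disjoint a (sSup s)) : sSupIndep (insert a s) := by
  intro x hx
  rcases eq_or_ne x a with rfl | hxa
  · refine ha.mono_right (sSup_le_sSup ?_)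
    rintro y ⟨hy | hy, hyx⟩
    · exact absurd hy hyx
    · exact hy
  · have hxs : x ∈ s := hx.resolve_left hxa
    have h1 : sSup (insert a s \ {x}) ≤ sSup (s \ {x}) ⊔ a := by
      refine sSup_le ?_
      rintro y ⟨rfl | hy, hyx⟩
      · exact le_sup_right
      · exact le_sup_of_le_left (le_sSup ⟨hy, hyx⟩)
    refine Disjoint.mono_right h1 ((hs hxs).disjoint_sup_right_of_disjoint_sup_left ?_)
    exact (ha.mono_right (sup_le (le_sSup hxs) (sSup_le_sSup Set.sdiff_subset))).symm

/-- A quasi-injective module whose cyclic submodules have finite length is a direct sum of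
hulls of simple submodules. -/
theorem IsQuasiInjective.exists_sSupIndep_isSimpleHull (hq : IsQuasiInjective A M)
    (hN : ∀ x : M, IsNoetherian A (Submodule.span A {x}))
    (hA : ∀ x : M, IsArtinian A (Submodule.span A {x})) :
    ∃ 𝒮 : Set (Submodule A M), sSupIndep 𝒮 ∧ sSup 𝒮 = ⊤ ∧ ∀ E ∈ 𝒮, E.IsSimpleHull := by
  have hatom : ∀ N : Submodule A M, N ≠ ⊥ → ∃ S ≤ N, IsAtom S := by
    intro N hN0
    obtain ⟨x, hx, hx0⟩ := N.ne_bot_iff.1 hN0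
    have := hA x
    have hne : Submodule.span A {x} ≠ ⊥ := by simpa using hx0
    have : Nontrivial (Submodule.span A {x}) := Submodule.nontrivial_iff_ne_bot.2 hne
    obtain ⟨S, hS⟩ := IsAtomic.exists_atom (Submodule A (Submodule.span A {x}))
    refine ⟨S.map (Submodule.span A {x}).subtype, (Submodule.map_subtype_le _ _).trans
      ((Submodule.span_singleton_le_iff_mem _ _).2 hx), ?_⟩
    exact ((Submodule.mapIic _).isAtom_iff S |>.2 hS).of_isAtom_coe_Iic
  obtain ⟨𝒮, h𝒮, hmax⟩ := zorn_subset
    {𝒮 : Set (Submodule A M) | sSupIndep 𝒮 ∧ ∀ E ∈ 𝒮, E.IsSimpleHull} (by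
    intro c hc hchain
    refine ⟨⋃₀ c, ⟨iSupIndep_sUnion_of_directed hchain.directedOn fun s hs => (hc hs).1, ?_⟩,
      fun s hs => Set.subset_sUnion_of_mem hs⟩
    rintro E ⟨s, hs, hE⟩
    exact (hc hs).2 E hE)
  -- A simple S outside the sum would have a hull independent of 𝒮, which could be added to the
  -- maximal family.
  have hsimple : ∀ S : Submodule A M, IsAtom S → S ≤ sSup 𝒮 := by
    intro S hS
    rw [← hS.not_disjoint_iff_le]
    intro hd
    obtain ⟨E, hSE, hE, hess⟩ := hq.exists_isSimpleHull hS
    have hEd : Disjoint E (sSup 𝒮) := by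
      rw [disjoint_iff]
      by_contra hne
      have h1 := hess _ inf_le_left hne
      exact hS.1 (eq_bot_iff.2 (hd le_rfl (h1.trans inf_le_right)))
    have hmem : E ∈ 𝒮 := by
      refine hmax ⟨sSupIndep_insert h𝒮.1 hEd, ?_⟩ (Set.subset_insert E 𝒮) (Set.mem_insert E 𝒮)
      rintro F (rfl | hF)
      · exact ⟨hE, S, hSE, hS, hess⟩
      · exact h𝒮.2 F hF
    exact hS.1 (eq_bot_iff.2 (hd le_rfl (hSE.trans (le_sSup hmem))))
  refine ⟨𝒮, h𝒮.1, ?_, h𝒮.2⟩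
  rw [Submodule.eq_top_iff']
  intro x
  set Z := Submodule.span A {x}
  -- The part of Z inside the whole sum already lies in a finite subsum, which is a summand of M by
  -- `IsRetract.finset_sup`.
  have hfg : (Z ⊓ sSup 𝒮).FG := isNoetherian_submodule.1 (hN x) _ inf_le_left
  obtain ⟨t, ht, hZt⟩ := (CompleteLattice.isCompactElement_iff_exists_le_sSup_of_le_sSup _ _).1
    ((Submodule.fg_iff_compact _).1 hfg) 𝒮 inf_le_right
  have htle : t.sup id ≤ sSup 𝒮 := Finset.sup_le fun E hE => le_sSup (ht hE)
  obtain ⟨Q, hQ⟩ := (Submodule.IsRetract.finset_sup hq h𝒮.1 (fun E hE => (h𝒮.2 E hE).1) t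
    ht).exists_isCompl
  -- A simple S in this intersection lies in the whole sum. By modularity it lies in the finite
  -- subsum plus Z ⊓ sSup 𝒮, hence in the finite subsum, which is disjoint from Q.
  have hX : (t.sup id ⊔ Z) ⊓ Q = ⊥ := by
    by_contra hne
    obtain ⟨S, hS, hSatom⟩ := hatom _ hne
    have h1 : S ≤ t.sup id := by
      refine (le_inf (hS.trans inf_le_left) (hsimple S hSatom)).trans ?_
      rw [sup_inf_assoc_of_le _ htle]
      exact sup_le le_rfl hZt
    exact hSatom.1 (eq_bot_iff.2 (hQ.1 h1 (hS.trans inf_le_right)))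
  have hle : t.sup id ⊔ Z ≤ t.sup id := by
    have h1 : (t.sup id ⊔ Z) ⊓ (t.sup id ⊔ Q) = t.sup id ⊔ (t.sup id ⊔ Z) ⊓ Q := by
      rw [inf_comm, inf_comm _ Q]
      exact sup_inf_assoc_of_le _ le_sup_left
    rw [hQ.sup_eq_top, inf_top_eq, hX, sup_bot_eq] at h1
    exact h1.le
  exact htle (hle (Submodule.mem_sup_right (Submodule.mem_span_singleton_self x)))

end QuasiInjective

/-! ## Left comodules and slices -/

section Slice

variable {K C M N : Type*} [Field K] [AddCommGroup C] [Module K C]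
  [AddCommGroup M] [Module K M] [AddCommGroup N] [Module K N]

/-- The map `C ⊗ M → M`, `c ⊗ m ↦ f(c) m`. -/
noncomputable def leftSlice (M : Type*) [AddCommGroup M] [Module K M] (f : Module.Dual K C) :
    C ⊗[K] M →ₗ[K] M :=
  (TensorProduct.lid K M).toLinearMap ∘ₗ f.rTensor M

@[simp]
theorem leftSlice_tmul (f : Module.Dual K C) (c : C) (m : M) :
    leftSlice M f (c ⊗ₜ m) = f c • m := by simp [leftSlice]

theorem leftSlice_lTensor (f : Module.Dual K C) (g : M →ₗ[K] N) (t : C ⊗[K] M) :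
    leftSlice N f (g.lTensor C t) = g (leftSlice M f t) := by
  induction t with
  | zero => simp
  | tmul c m => simp
  | add x y hx hy => simp [hx, hy]

theorem eq_sum_leftSlice {ι : Type*} (B : Module.Basis ι K C) (t : C ⊗[K] M) :
    ∃ s : Finset ι, t = ∑ i ∈ s, B i ⊗ₜ leftSlice M (B.coord i) t := by
  classical
  obtain ⟨s, rfl⟩ := (TensorProduct.equivFinsuppOfBasisLeft (N := M) B).symm.surjective t
  refine ⟨s.support, ?_⟩
  rw [TensorProduct.equivFinsuppOfBasisLeft_symm_apply, Finsupp.sum]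
  refine Finset.sum_congr rfl fun i hi => ?_
  rw [map_sum, Finset.sum_eq_single_of_mem i hi]
  · simp
  · intro j _ hj
    simp [Finsupp.single_eq_of_ne hj.symm]

theorem ext_leftSlice {t t' : C ⊗[K] M} (h : ∀ f, leftSlice M f t = leftSlice M f t') :
    t = t' := by
  rw [← sub_eq_zero]
  obtain ⟨s, hs⟩ := eq_sum_leftSlice (Module.Free.chooseBasis K C) (t - t')
  rw [hs]
  exact Finset.sum_eq_zero fun i _ => by rw [map_sub, h, sub_self, TensorProduct.tmul_zero]

theorem mem_range_lTensor_iff_leftSlice {P : Submodule K M} {t : C ⊗[K] M} :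
    t ∈ LinearMap.range (P.subtype.lTensor C) ↔ ∀ f, leftSlice M f t ∈ P := by
  constructor
  · rintro ⟨t, rfl⟩ f
    rw [leftSlice_lTensor]
    exact Subtype.prop _
  · intro h
    obtain ⟨s, hs⟩ := eq_sum_leftSlice (Module.Free.chooseBasis K C) t
    rw [hs]
    exact Submodule.sum_mem _ fun i _ => ⟨_ ⊗ₜ ⟨_, h _⟩, by rw [LinearMap.lTensor_tmul]; rfl⟩

end Slice

/-! ### Subcomodules, comodule maps and coinduced maps into C -/

section LeftComodule

variable {K C : Type*} [Field K] [AddCommGroup C] [Module K C]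
  {M N : Type*} [AddCommGroup M] [Module K M] [AddCommGroup N] [Module K N]
  {ρ : M →ₗ[K] C ⊗[K] M} {σ : N →ₗ[K] C ⊗[K] N}

/-- Slicing turns the tensor condition into invariance under operators, so that subcomodules can be
treated as submodules. -/
theorem isLeftSubcomodule_iff {P : Submodule K M} :
    IsLeftSubcomodule ρ P ↔ ∀ x ∈ P, ∀ f, leftSlice M f (ρ x) ∈ P :=
  forall₂_congr fun _ _ => mem_range_lTensor_iff_leftSlice

theorem IsLeftSubcomodule.inf {P Q : Submodule K M} (hP : IsLeftSubcomodule ρ P)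
    (hQ : IsLeftSubcomodule ρ Q) : IsLeftSubcomodule ρ (P ⊓ Q) := by
  rw [isLeftSubcomodule_iff] at *
  exact fun x hx f => ⟨hP x hx.1 f, hQ x hx.2 f⟩

theorem IsLeftSubcomodule.iSup {ι : Sort*} {P : ι → Submodule K M}
    (hP : ∀ i, IsLeftSubcomodule ρ (P i)) : IsLeftSubcomodule ρ (⨆ i, P i) := by
  simp only [isLeftSubcomodule_iff] at *
  intro x hx f
  have : (⨆ i, P i) ≤ (⨆ i, P i).comap (leftSlice M f ∘ₗ ρ) :=
    iSup_le fun i y hy => Submodule.mem_iSup_of_mem i (hP i y hy f)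
  exact this hx

theorem isLeftComoduleHom_iff {φ : M →ₗ[K] N} :
    IsLeftComoduleHom ρ σ φ ↔ ∀ x f, leftSlice N f (σ (φ x)) = φ (leftSlice M f (ρ x)) := by
  constructor
  · intro h x f
    rw [← leftSlice_lTensor]
    exact congrArg _ (LinearMap.congr_fun h x)
  · intro h
    refine LinearMap.ext fun x => ext_leftSlice fun f => ?_
    rw [LinearMap.comp_apply, LinearMap.comp_apply, h, leftSlice_lTensor]

theorem leftSlice_leftRestrict {P : Submodule K M} (hP : IsLeftSubcomodule ρ P) (x : P)
    (f : Module.Dual K C) :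
    (leftSlice P f (leftRestrict ρ P hP x) : M) = leftSlice M f (ρ x) := by
  have := LinearMap.congr_fun (lTensor_comp_leftRestrict ρ P hP) x
  rw [LinearMap.comp_apply, LinearMap.comp_apply] at this
  have h2 := leftSlice_lTensor f P.subtype (leftRestrict ρ P hP x)
  rw [this] at h2
  exact h2.symm

theorem isLeftComoduleHom_subtype {P : Submodule K M} (hP : IsLeftSubcomodule ρ P) :
    IsLeftComoduleHom (leftRestrict ρ P hP) ρ P.subtype :=
  (lTensor_comp_leftRestrict ρ P hP).symm

theorem isLeftSubcomodule_map_subtype_iff {P : Submodule K M} (hP : IsLeftSubcomodule ρ P)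
    {Q : Submodule K P} :
    IsLeftSubcomodule ρ (Q.map P.subtype) ↔ IsLeftSubcomodule (leftRestrict ρ P hP) Q := by
  simp only [isLeftSubcomodule_iff]
  constructor
  · intro h x hx f
    obtain ⟨y, hy, hyx⟩ := h x ⟨x, hx, rfl⟩ f
    rw [Submodule.subtype_apply, ← leftSlice_leftRestrict hP] at hyx
    rwa [← Subtype.ext hyx]
  · rintro h _ ⟨x, hx, rfl⟩ f
    exact ⟨_, h x hx f, leftSlice_leftRestrict hP x f⟩

/-- An injective hull of a simple comodule is indecomposable. -/
theorem IsLeftIndecomposable.of_essential {S : Submodule K M} (hS : IsLeftSubcomodule ρ S)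
    (hS0 : S ≠ ⊥) (hmin : ∀ N : Submodule K M, IsLeftSubcomodule ρ N → N ≤ S → N = ⊥ ∨ N = S)
    (hess : ∀ N : Submodule K M, IsLeftSubcomodule ρ N → N ≠ ⊥ → N ⊓ S ≠ ⊥) :
    IsLeftIndecomposable ρ := by
  have key : ∀ N : Submodule K M, IsLeftSubcomodule ρ N → N ≠ ⊥ → S ≤ N := fun N hN hN0 =>
    inf_eq_right.1 ((hmin _ (hN.inf hS) inf_le_right).resolve_left (hess N hN hN0))
  refine ⟨?_, fun N P hN hP hNP => ?_⟩
  · obtain ⟨x, -, hx⟩ := S.ne_bot_iff.1 hS0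
    exact ⟨x, 0, hx⟩
  · by_contra! h
    exact hS0 (eq_bot_iff.2 (hNP.1 (key N hN h.1) (key P hP h.2)))

/-- The comodule homomorphism `m ↦ ∑ m₍₋₁₎ h(m₍₀₎)` from `M` to `C`. -/
noncomputable def leftCoinduced (ρ : M →ₗ[K] C ⊗[K] M) (h : Module.Dual K M) : M →ₗ[K] C :=
  (TensorProduct.rid K C).toLinearMap ∘ₗ h.lTensor C ∘ₗ ρ

theorem leftCoinduced_comp {φ : M →ₗ[K] N} (hφ : IsLeftComoduleHom ρ σ φ) (h : Module.Dual K N) :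
    leftCoinduced σ h ∘ₗ φ = leftCoinduced ρ (h ∘ₗ φ) := by
  rw [leftCoinduced, LinearMap.comp_assoc, LinearMap.comp_assoc, hφ, leftCoinduced,
    LinearMap.lTensor_comp]
  rfl

variable [Coalgebra K C]

/-- C ⊗ C ⊗ P embeds in C ⊗ C ⊗ M by flatness, so coassociativity can be checked there, where it is
that of ρ. -/
theorem IsLeftCoaction.leftRestrict (hρ : IsLeftCoaction ρ) {P : Submodule K M}
    (hP : IsLeftSubcomodule ρ P) : IsLeftCoaction (leftRestrict ρ P hP) := by
  have hι := lTensor_comp_leftRestrict ρ P hP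
  set τ := _root_.leftRestrict ρ P hP
  constructor
  · have hinj : Function.Injective ((P.subtype.lTensor C).lTensor C) :=
      Module.Flat.lTensor_preserves_injective_linearMap _
        (Module.Flat.lTensor_preserves_injective_linearMap _ P.injective_subtype)
    rw [← LinearMap.cancel_left hinj]
    have h1 : (P.subtype.lTensor C).lTensor C ∘ₗ (TensorProduct.assoc K C C P).toLinearMap ∘ₗ
        (Coalgebra.comul (R := K) (A := C)).rTensor P =
        (TensorProduct.assoc K C C M).toLinearMap ∘ₗ
          (Coalgebra.comul (R := K) (A := C)).rTensor M ∘ₗ P.subtype.lTensor C := by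
      refine TensorProduct.ext' fun c x => ?_
      simp only [LinearMap.comp_apply, LinearMap.rTensor_tmul, LinearMap.lTensor_tmul]
      generalize Coalgebra.comul (R := K) c = t
      induction t with
      | zero => simp
      | tmul a b => simp
      | add a b ha hb => simp_all [TensorProduct.add_tmul]
    calc (P.subtype.lTensor C).lTensor C ∘ₗ (TensorProduct.assoc K C C P).toLinearMap ∘ₗ
          (Coalgebra.comul (R := K) (A := C)).rTensor P ∘ₗ τ
        = ((P.subtype.lTensor C).lTensor C ∘ₗ (TensorProduct.assoc K C C P).toLinearMap ∘ₗ
          (Coalgebra.comul (R := K) (A := C)).rTensor P) ∘ₗ τ := rfl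
      _ = ((TensorProduct.assoc K C C M).toLinearMap ∘ₗ
          (Coalgebra.comul (R := K) (A := C)).rTensor M) ∘ₗ (P.subtype.lTensor C ∘ₗ τ) := by
        rw [h1]; rfl
      _ = ((TensorProduct.assoc K C C M).toLinearMap ∘ₗ
          (Coalgebra.comul (R := K) (A := C)).rTensor M ∘ₗ ρ) ∘ₗ P.subtype := by rw [hι]; rfl
      _ = ρ.lTensor C ∘ₗ P.subtype.lTensor C ∘ₗ τ := by rw [hρ.coassoc, hι]; rfl
      _ = (P.subtype.lTensor C).lTensor C ∘ₗ τ.lTensor C ∘ₗ τ := by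
        rw [← LinearMap.comp_assoc, ← LinearMap.comp_assoc, ← LinearMap.lTensor_comp,
          ← LinearMap.lTensor_comp, hι]
  · refine LinearMap.ext fun x => Subtype.ext ?_
    refine (leftSlice_leftRestrict hP x Coalgebra.counit).trans ?_
    exact LinearMap.congr_fun hρ.counit x

theorem isLeftComoduleHom_leftCoinduced (hρ : IsLeftCoaction ρ) (h : Module.Dual K M) :
    IsLeftComoduleHom ρ Coalgebra.comul (leftCoinduced ρ h) := by
  have h1 : (Coalgebra.comul (R := K) (A := C)) ∘ₗ (TensorProduct.rid K C).toLinearMap ∘ₗ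
      h.lTensor C = ((TensorProduct.rid K C).toLinearMap ∘ₗ h.lTensor C).lTensor C ∘ₗ
        (TensorProduct.assoc K C C M).toLinearMap ∘ₗ
          (Coalgebra.comul (R := K) (A := C)).rTensor M := by
    refine TensorProduct.ext' fun c x => ?_
    simp only [LinearMap.comp_apply, LinearMap.rTensor_tmul, LinearMap.lTensor_tmul,
      LinearEquiv.coe_coe, TensorProduct.rid_tmul, map_smul]
    generalize Coalgebra.comul (R := K) c = t
    induction t with
    | zero => simp
    | tmul a b => simp
    | add a b ha hb => simp_all [TensorProduct.add_tmul]
  calc Coalgebra.comul ∘ₗ leftCoinduced ρ h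
      = (Coalgebra.comul (R := K) (A := C) ∘ₗ (TensorProduct.rid K C).toLinearMap ∘ₗ
          h.lTensor C) ∘ₗ ρ := rfl
    _ = ((TensorProduct.rid K C).toLinearMap ∘ₗ h.lTensor C).lTensor C ∘ₗ
        ((TensorProduct.assoc K C C M).toLinearMap ∘ₗ
          (Coalgebra.comul (R := K) (A := C)).rTensor M ∘ₗ ρ) := by rw [h1]; rfl
    _ = (leftCoinduced ρ h).lTensor C ∘ₗ ρ := by
      rw [hρ.coassoc, ← LinearMap.comp_assoc, ← LinearMap.lTensor_comp]; rfl

theorem leftCoinduced_counit :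
    leftCoinduced (Coalgebra.comul (R := K) (A := C)) Coalgebra.counit = LinearMap.id := by
  ext c
  simp [leftCoinduced]

/-- Together with `isLeftComoduleHom_leftCoinduced` this says that C is cofree: a comodule map into
C is determined by its composite with ε, and every functional arises. -/
theorem IsLeftComoduleHom.eq_leftCoinduced {φ : M →ₗ[K] C}
    (hφ : IsLeftComoduleHom ρ Coalgebra.comul φ) :
    φ = leftCoinduced ρ (Coalgebra.counit ∘ₗ φ) := by
  rw [← leftCoinduced_comp hφ, leftCoinduced_counit, LinearMap.id_comp]

theorem isLeftCoaction_comul : IsLeftCoaction (Coalgebra.comul (R := K) (A := C)) := by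
  constructor
  · exact Coalgebra.coassoc
  · ext c
    simp


end LeftComodule

/-! ### Injectivity of C and of its direct summands -/

section InjectiveComodule

variable {K : Type u} [Field K] {C : Type v} [AddCommGroup C] [Module K C] [Coalgebra K C]

/-- The direct summands of the left comodule `C` are injective. -/
theorem isLeftInjective_leftRestrict {P : Submodule K C}
    (hP : IsLeftSubcomodule (Coalgebra.comul (R := K) (A := C)) P) {r : C →ₗ[K] C}
    (hr : IsLeftComoduleHom Coalgebra.comul Coalgebra.comul r) (hrP : ∀ x, r x ∈ P)
    (hid : ∀ x ∈ P, r x = x) : IsLeftInjective (leftRestrict Coalgebra.comul P hP) := by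
  intro X Y _ _ _ _ ρX ρY hX hY i f hi hinj hf
  have hf' : IsLeftComoduleHom ρX Coalgebra.comul (P.subtype ∘ₗ f) := by
    rw [isLeftComoduleHom_iff] at hf ⊢
    intro x h
    rw [LinearMap.comp_apply, LinearMap.comp_apply, ← hf, Submodule.subtype_apply,
      Submodule.subtype_apply, leftSlice_leftRestrict]
  obtain ⟨s, hs⟩ := i.exists_leftInverse_of_injective (LinearMap.ker_eq_bot.2 hinj)
  -- By cofreeness it is enough to extend a functional along i; the linear left inverse s does this.
  -- The coinduced map is then retracted onto P by r.
  let h : Module.Dual K Y := (Coalgebra.counit ∘ₗ P.subtype ∘ₗ f) ∘ₗ s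
  have hg := isLeftComoduleHom_leftCoinduced hY h
  have hgi : leftCoinduced ρY h ∘ₗ i = P.subtype ∘ₗ f := by
    rw [leftCoinduced_comp hi, hf'.eq_leftCoinduced, LinearMap.comp_assoc, hs, LinearMap.comp_id]
  refine ⟨(r ∘ₗ leftCoinduced ρY h).codRestrict P fun y => hrP _, ?_, ?_⟩
  · rw [isLeftComoduleHom_iff] at hg hr ⊢
    intro y k
    refine Subtype.ext ?_
    rw [leftSlice_leftRestrict]
    exact (hr _ _).trans (congrArg r (hg y k))
  · refine LinearMap.ext fun x => Subtype.ext ?_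
    have := LinearMap.congr_fun hgi x
    rw [LinearMap.comp_apply, LinearMap.comp_apply] at this
    change r (leftCoinduced ρY h (i x)) = f x
    rw [this]
    exact hid _ (f x).2

theorem isLeftInjective_comul : IsLeftInjective (Coalgebra.comul (R := K) (A := C)) := by
  intro X Y _ _ _ _ ρX ρY hX hY i f hi hinj hf
  obtain ⟨s, hs⟩ := i.exists_leftInverse_of_injective (LinearMap.ker_eq_bot.2 hinj)
  refine ⟨leftCoinduced ρY ((Coalgebra.counit ∘ₗ f) ∘ₗ s),
    isLeftComoduleHom_leftCoinduced hY _, ?_⟩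
  rw [leftCoinduced_comp hi, LinearMap.comp_assoc, hs, LinearMap.comp_id, ← hf.eq_leftCoinduced]

theorem IsInjectiveHullOfLeftSimple.finiteDimensional (hr : IsRightSemiperfect K C)
    {M : Type v} [AddCommGroup M] [Module K M] {ρ : M →ₗ[K] C ⊗[K] M} (hρ : IsLeftCoaction ρ)
    (h : IsInjectiveHullOfLeftSimple ρ) : FiniteDimensional K M := by
  obtain ⟨hinj, S, ⟨hS, hS0, hmin⟩, hess⟩ := h
  exact hr M ρ hρ hinj (.of_essential hS hS0 hmin hess)

theorem IsLeftInjectiveDecomposition.finiteDimensional (hr : IsRightSemiperfect K C)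
    {J : Type*} {E : J → Submodule K C} (hE : IsLeftInjectiveDecomposition E) (j : J) :
    FiniteDimensional K (E j) :=
  (hE.hull j).finiteDimensional hr (isLeftCoaction_comul.leftRestrict (hE.subcomodule j))

end InjectiveComodule

/-! ### Left subcomodules of C as submodules; the decomposition of C -/

section ActionAlgebra

variable (K : Type u) [Field K] (C : Type v) [AddCommGroup C] [Module K C] [Coalgebra K C]

/-- The algebra of the endomorphisms `c ↦ ∑ f(c₁) c₂` of `C`, whose invariant subspaces are
the left subcomodules of `C`. -/
def leftActionAlgebra : Subalgebra K (Module.End K C) :=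
  Algebra.adjoin K (Set.range fun f : Module.Dual K C => leftSlice C f ∘ₗ Coalgebra.comul)

variable {K C}

/-- The element `c ↦ ∑ f(c₁) c₂` of `leftActionAlgebra`. -/
noncomputable def leftAction (f : Module.Dual K C) : leftActionAlgebra K C :=
  ⟨leftSlice C f ∘ₗ Coalgebra.comul, Algebra.subset_adjoin ⟨f, rfl⟩⟩

/-- A left subcomodule of `C` as a submodule over the action algebra. -/
def IsLeftSubcomodule.toActionSubmodule {P : Submodule K C}
    (hP : IsLeftSubcomodule (Coalgebra.comul (R := K) (A := C)) P) :
    Submodule (leftActionAlgebra K C) C where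
  carrier := P
  zero_mem' := P.zero_mem
  add_mem' := P.add_mem
  smul_mem' := by
    rintro ⟨a, ha⟩ x hx
    revert x
    change ∀ x, x ∈ P → a x ∈ P
    induction ha using Algebra.adjoin_induction with
    | mem a ha =>
      obtain ⟨f, rfl⟩ := ha
      exact fun x hx => isLeftSubcomodule_iff.1 hP x hx f
    | algebraMap k => exact fun x hx => P.smul_mem k hx
    | add a b _ _ iha ihb => exact fun x hx => P.add_mem (iha x hx) (ihb x hx)
    | mul a b _ _ iha ihb => exact fun x hx => iha _ (ihb x hx)

theorem isLeftSubcomodule_restrictScalars (N : Submodule (leftActionAlgebra K C) C) :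
    IsLeftSubcomodule (Coalgebra.comul (R := K) (A := C)) (N.restrictScalars K) :=
  isLeftSubcomodule_iff.2 fun _ hx f => N.smul_mem (leftAction f) hx

theorem isLeftComoduleHom_restrictScalars (g : C →ₗ[leftActionAlgebra K C] C) :
    IsLeftComoduleHom (Coalgebra.comul (R := K) (A := C)) Coalgebra.comul
      (g.restrictScalars K) :=
  isLeftComoduleHom_iff.2 fun x f => (g.map_smul (leftAction f) x).symm

/-- A comodule endomorphism of `C` is linear over the action algebra. -/
def IsLeftComoduleHom.toActionLinearMap {g : C →ₗ[K] C}
    (hg : IsLeftComoduleHom (Coalgebra.comul (R := K) (A := C)) Coalgebra.comul g) :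
    C →ₗ[leftActionAlgebra K C] C where
  toFun := g
  map_add' := g.map_add
  map_smul' := by
    rintro ⟨a, ha⟩
    change ∀ x, g (a x) = a (g x)
    induction ha using Algebra.adjoin_induction with
    | mem a ha =>
      obtain ⟨f, rfl⟩ := ha
      intro x
      exact (isLeftComoduleHom_iff.1 hg x f).symm
    | algebraMap k => exact fun x => g.map_smul k x
    | add a b _ _ iha ihb =>
      intro x
      rw [LinearMap.add_apply, LinearMap.add_apply, map_add, iha, ihb]
    | mul a b _ _ iha ihb =>
      intro x
      rw [Module.End.mul_apply, Module.End.mul_apply, iha, ihb]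

/-- Submodules and linear maps over the action algebra are subcomodules and comodule maps, so this
is the injectivity of the comodule C. -/
theorem isQuasiInjective_leftActionAlgebra : IsQuasiInjective (leftActionAlgebra K C) C := by
  intro N f
  have hN := isLeftSubcomodule_restrictScalars N
  obtain ⟨g, hg, hgf⟩ := isLeftInjective_comul (K := K) (C := C) (N.restrictScalars K) C
    (leftRestrict _ _ hN) Coalgebra.comul (isLeftCoaction_comul.leftRestrict hN)
    isLeftCoaction_comul (N.restrictScalars K).subtype (f.restrictScalars K)
    (isLeftComoduleHom_subtype hN) (Submodule.injective_subtype _) (by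
      refine isLeftComoduleHom_iff.2 fun x h => ?_
      refine (f.map_smul (leftAction h) x).symm.trans ?_
      exact congrArg f (Subtype.ext (leftSlice_leftRestrict hN x h).symm))
  exact ⟨hg.toActionLinearMap, fun x => LinearMap.congr_fun hgf x⟩

/-- Every element of `C` lies in a finite dimensional left subcomodule. -/
theorem exists_finiteDimensional_leftSubcomodule (c : C) :
    ∃ P : Submodule K C, IsLeftSubcomodule (Coalgebra.comul (R := K) (A := C)) P ∧
      FiniteDimensional K P ∧ c ∈ P := by
  let s : Module.Dual K C →ₗ[K] C :=
    { toFun := fun f => leftSlice C f (Coalgebra.comul c)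
      map_add' := fun f g => by simp [leftSlice, LinearMap.rTensor_add]
      map_smul' := fun a f => by simp [leftSlice, LinearMap.rTensor_smul] }
  refine ⟨LinearMap.range s, ?_, ?_, Coalgebra.counit, ?_⟩
  · rw [isLeftSubcomodule_iff]
    rintro _ ⟨f, rfl⟩ g
    -- Coassociativity: slicing c by f and then by g gives ∑ f(c₁) g(c₂) c₃, the slice by the
    -- product fg.
    refine ⟨((WithConv.toConv f : DualAlgebra K C) * WithConv.toConv g).ofConv, ?_⟩
    change leftSlice C _ (Coalgebra.comul c) = leftSlice C g (Coalgebra.comul (leftSlice C f _))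
    have h1 : leftSlice C ((WithConv.toConv f : DualAlgebra K C) * WithConv.toConv g).ofConv =
        leftSlice C g ∘ₗ leftSlice (C ⊗[K] C) f ∘ₗ
          (TensorProduct.assoc K C C C).toLinearMap ∘ₗ
            (Coalgebra.comul (R := K) (A := C)).rTensor C := by
      refine TensorProduct.ext' fun a b => ?_
      simp only [LinearMap.comp_apply, LinearMap.rTensor_tmul, leftSlice_tmul,
        LinearMap.convMul_def]
      generalize Coalgebra.comul (R := K) a = t
      induction t with
      | zero => simp
      | tmul a b => simp [mul_smul]
      | add a b ha hb => simp_all [TensorProduct.add_tmul, add_smul]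
    rw [h1, ← leftSlice_lTensor]
    simp only [LinearMap.comp_apply]
    rw [← Coalgebra.coassoc_apply]
    rfl
  · obtain ⟨t, ht⟩ := TensorProduct.exists_finset (Coalgebra.comul (R := K) c)
    have : LinearMap.range s ≤ Submodule.span K (Prod.snd '' (t : Set (C × C))) := by
      rintro _ ⟨f, rfl⟩
      change leftSlice C f (Coalgebra.comul c) ∈ _
      rw [ht, map_sum]
      refine Submodule.sum_mem _ fun i hi => ?_
      rw [leftSlice_tmul]
      refine Submodule.smul_mem _ _ (Submodule.subset_span ?_)
      exact ⟨i, hi, rfl⟩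
    have := FiniteDimensional.span_of_finite K (t.finite_toSet.image Prod.snd)
    exact Submodule.finiteDimensional_of_le ‹_ ≤ _›
  · change leftSlice C _ (Coalgebra.comul c) = c
    simp [leftSlice]

theorem finiteDimensional_span_leftActionAlgebra (c : C) :
    FiniteDimensional K
      ((Submodule.span (leftActionAlgebra K C) {c}).restrictScalars K) := by
  obtain ⟨P, hP, hfin, hc⟩ := exists_finiteDimensional_leftSubcomodule (K := K) c
  have hle : (Submodule.span (leftActionAlgebra K C) {c}).restrictScalars K ≤ P :=
    fun x hx => (Submodule.span_singleton_le_iff_mem c hP.toActionSubmodule).2 hc hx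
  exact Submodule.finiteDimensional_of_le hle

theorem exists_sSupIndep_isSimpleHull (K : Type u) (C : Type v) [Field K] [AddCommGroup C]
    [Module K C] [Coalgebra K C] : ∃ 𝒮 : Set (Submodule (leftActionAlgebra K C) C),
      sSupIndep 𝒮 ∧ sSup 𝒮 = ⊤ ∧ ∀ E ∈ 𝒮, E.IsSimpleHull := by
  have hfin : ∀ c : C, FiniteDimensional K
      ((Submodule.span (leftActionAlgebra K C) {c}).restrictScalars K) :=
    finiteDimensional_span_leftActionAlgebra
  have htower : ∀ N : Submodule (leftActionAlgebra K C) C,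
      IsScalarTower K (leftActionAlgebra K C) (N.restrictScalars K) :=
    fun N => ⟨fun k a x => Subtype.ext (smul_assoc k a x.1)⟩
  refine isQuasiInjective_leftActionAlgebra.exists_sSupIndep_isSimpleHull (fun c => ?_)
    fun c => ?_
  · have := hfin c
    exact @isNoetherian_of_tower K (leftActionAlgebra K C)
      ((Submodule.span (leftActionAlgebra K C) {c}).restrictScalars K)
      _ _ _ _ _ _ (htower _) inferInstance
  · have := hfin c
    exact @isArtinian_of_tower K (leftActionAlgebra K C)
      ((Submodule.span (leftActionAlgebra K C) {c}).restrictScalars K)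
      _ _ _ _ _ _ (htower _) inferInstance

theorem Submodule.IsSimpleHull.isInjectiveHullOfLeftSimple
    {E : Submodule (leftActionAlgebra K C) C} (hE : E.IsSimpleHull) :
    IsInjectiveHullOfLeftSimple
      (leftRestrict _ _ (isLeftSubcomodule_restrictScalars E)) := by
  have hP := isLeftSubcomodule_restrictScalars E
  obtain ⟨⟨g, hg, hgE⟩, S, hSE, hS, hess⟩ := hE
  have hne : (S.restrictScalars K).comap (E.restrictScalars K).subtype ≠ ⊥ := by
    obtain ⟨x, hx, hx0⟩ := S.ne_bot_iff.1 hS.1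
    exact (Submodule.ne_bot_iff _).2 ⟨⟨x, hSE hx⟩, hx, fun h => hx0 (congrArg Subtype.val h)⟩
  refine ⟨isLeftInjective_leftRestrict hP (isLeftComoduleHom_restrictScalars g) hg hgE,
    (S.restrictScalars K).comap (E.restrictScalars K).subtype, ⟨?_, ?_, ?_⟩, ?_⟩
  · rw [← isLeftSubcomodule_map_subtype_iff hP, Submodule.map_comap_subtype,
      inf_eq_right.2 (show S.restrictScalars K ≤ E.restrictScalars K from hSE)]
    exact isLeftSubcomodule_restrictScalars S
  · exact hne
  · intro N hN hNS
    rw [← isLeftSubcomodule_map_subtype_iff hP] at hN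
    have hle : hN.toActionSubmodule ≤ S := by
      rintro _ ⟨x, hx, rfl⟩
      exact hNS hx
    refine (hS.le_iff.1 hle).imp (fun h => ?_) (fun h => le_antisymm hNS fun x hx => ?_)
    · refine (Submodule.eq_bot_iff _).2 fun x hx => Subtype.ext ?_
      have : (x : C) ∈ hN.toActionSubmodule := ⟨x, hx, rfl⟩
      rw [h] at this
      exact (Submodule.mem_bot _).1 this
    · have : (x : C) ∈ hN.toActionSubmodule := by
        rw [h]
        exact hx
      obtain ⟨y, hy, hyx⟩ := this
      rwa [← Subtype.ext hyx]
  · intro N hN hN0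
    rw [← isLeftSubcomodule_map_subtype_iff hP] at hN
    have hle : S ≤ hN.toActionSubmodule := by
      refine hess _ ?_ ?_
      · rintro _ ⟨x, hx, rfl⟩
        exact x.2
      · obtain ⟨x, hx, hx0⟩ := N.ne_bot_iff.1 hN0
        exact (Submodule.ne_bot_iff _).2 ⟨x, ⟨x, hx, rfl⟩, fun h => hx0 (Subtype.ext h)⟩
    rw [inf_eq_right.2]
    · exact hne
    · intro x hx
      obtain ⟨y, hy, hyx⟩ := hle hx
      rwa [← Subtype.ext hyx]

/-- The left comodule `C` is a direct sum of injective hulls of simple comodules. -/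
theorem exists_isLeftInjectiveDecomposition (K : Type u) (C : Type v) [Field K] [AddCommGroup C]
    [Module K C] [Coalgebra K C] :
    ∃ (J : Type v) (E : J → Submodule K C), IsLeftInjectiveDecomposition E := by
  obtain ⟨𝒮, hi, htop, h𝒮⟩ := exists_sSupIndep_isSimpleHull K C
  refine ⟨𝒮, fun E => E.1.restrictScalars K, fun E => isLeftSubcomodule_restrictScalars E.1,
    fun E => ?_, ?_, fun E => (h𝒮 E.1 E.2).isInjectiveHullOfLeftSimple⟩
  · rw [Submodule.disjoint_def]
    intro x hx hx'
    have hle : (⨆ (F : 𝒮) (_ : F ≠ E), F.1.restrictScalars K) ≤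
        (sSup (𝒮 \ {E.1})).restrictScalars K := by
      refine iSup₂_le fun F hF y hy => ?_
      have hmem : F.1 ∈ 𝒮 \ {E.1} := ⟨F.2, fun h => hF (Subtype.ext h)⟩
      exact le_sSup hmem hy
    exact Submodule.disjoint_def.1 (hi E.2) x hx (hle hx')
  · have hP := IsLeftSubcomodule.iSup fun E : 𝒮 => isLeftSubcomodule_restrictScalars E.1
    have : sSup 𝒮 ≤ hP.toActionSubmodule := sSup_le fun E hE x hx =>
      Submodule.mem_iSup_of_mem (p := fun E : 𝒮 => E.1.restrictScalars K) ⟨E, hE⟩ hx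
    rw [htop] at this
    exact Submodule.eq_top_iff'.2 fun x => this trivial

/-- Over a right semiperfect coalgebra, every finite dimensional subspace of `C` lies in a finite
dimensional direct summand of the left comodule `C`. -/
theorem IsRightSemiperfect.exists_finiteDimensional_retract (hr : IsRightSemiperfect K C)
    (T : Finset C) :
    ∃ (P : Submodule K C) (r : C →ₗ[K] C), FiniteDimensional K P ∧ ↑T ⊆ (P : Set C) ∧
      IsLeftComoduleHom (Coalgebra.comul (R := K) (A := C)) Coalgebra.comul r ∧
      (∀ x, r x ∈ P) ∧ ∀ x ∈ P, r x = x := by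
  classical
  obtain ⟨𝒮, hi, htop, h𝒮⟩ := exists_sSupIndep_isSimpleHull K C
  have hfin : ∀ E ∈ 𝒮, FiniteDimensional K (E.restrictScalars K) := fun E hE =>
    (h𝒮 E hE).isInjectiveHullOfLeftSimple.finiteDimensional hr
      (isLeftCoaction_comul.leftRestrict (isLeftSubcomodule_restrictScalars E))
  -- The submodule generated by the finite set T is compact, so finitely many hulls contain it; each
  -- is finite dimensional by right semiperfectness.
  obtain ⟨t, ht, hTt⟩ := (CompleteLattice.isCompactElement_iff_exists_le_sSup_of_le_sSup _ _).1
    ((Submodule.fg_iff_compact _).1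
      (Submodule.fg_span (R := leftActionAlgebra K C) T.finite_toSet)) 𝒮 (htop ▸ le_top)
  obtain ⟨g, hg, hgt⟩ := Submodule.IsRetract.finset_sup isQuasiInjective_leftActionAlgebra hi
    (fun E hE => (h𝒮 E hE).1) t ht
  refine ⟨(t.sup id).restrictScalars K, g.restrictScalars K, ?_,
    fun x hx => hTt (Submodule.subset_span hx), isLeftComoduleHom_restrictScalars g, hg, hgt⟩
  clear hTt hgt hg g
  induction t using Finset.induction_on with
  | empty =>
    rw [Finset.sup_empty, Submodule.restrictScalars_bot]
    infer_instance
  | insert E t hE ih =>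
    rw [Finset.coe_insert, Set.insert_subset_iff] at ht
    have : FiniteDimensional K ((id E).restrictScalars K) := hfin E ht.1
    have := ih ht.2
    rw [Finset.sup_insert, Submodule.restrictScalars_sup]
    exact Submodule.finiteDimensional_sup _ _

end ActionAlgebra

/-! ## The coopposite coalgebra -/

section Reverse

variable {K C M : Type*} [Field K] [AddCommGroup C] [Module K C] [AddCommGroup M] [Module K M]

variable (K C M) in
/-- The map `m ⊗ (a ⊗ b) ↦ b ⊗ (a ⊗ m)`. -/
noncomputable def tensorReverse : M ⊗[K] (C ⊗[K] C) ≃ₗ[K] C ⊗[K] (C ⊗[K] M) :=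
  TensorProduct.comm K M (C ⊗[K] C) ≪≫ₗ (TensorProduct.comm K C C).rTensor M ≪≫ₗ
    TensorProduct.assoc K C C M

@[simp]
theorem tensorReverse_tmul (m : M) (a b : C) :
    tensorReverse K C M (m ⊗ₜ (a ⊗ₜ b)) = b ⊗ₜ (a ⊗ₜ m) := rfl

/-- With `lTensor_comm_comp_comm`: reversing the tensor factors carries the two sides of right
coassociativity to the two sides, in the other order, of coassociativity over the coopposite. -/
theorem assoc_comp_rTensor_comm_comp_comm (d : C →ₗ[K] C ⊗[K] C) :
    (TensorProduct.assoc K C C M).toLinearMap ∘ₗ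
      ((TensorProduct.comm K C C).toLinearMap ∘ₗ d).rTensor M ∘ₗ
        (TensorProduct.comm K M C).toLinearMap =
      (tensorReverse K C M).toLinearMap ∘ₗ d.lTensor M := by
  refine TensorProduct.ext' fun m c => ?_
  simp only [LinearMap.comp_apply, LinearEquiv.coe_coe, TensorProduct.comm_tmul,
    LinearMap.rTensor_tmul, LinearMap.lTensor_tmul]
  rfl

theorem lTensor_comm_comp_comm (ρ : M →ₗ[K] M ⊗[K] C) :
    ((TensorProduct.comm K M C).toLinearMap ∘ₗ ρ).lTensor C ∘ₗ
        (TensorProduct.comm K M C).toLinearMap =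
      (tensorReverse K C M).toLinearMap ∘ₗ (TensorProduct.assoc K M C C).toLinearMap ∘ₗ
        ρ.rTensor C := by
  refine TensorProduct.ext' fun m c => ?_
  simp only [LinearMap.comp_apply, LinearEquiv.coe_coe, TensorProduct.comm_tmul,
    LinearMap.rTensor_tmul, LinearMap.lTensor_tmul]
  generalize ρ m = t
  induction t with
  | zero => simp
  | tmul a b => simp
  | add a b ha hb => simp_all [TensorProduct.add_tmul, TensorProduct.tmul_add]

end Reverse

/-- The coopposite of a coalgebra: the same space, with the two factors of the comultiplication
exchanged. -/
def Coopposite (C : Type*) : Type _ := C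

namespace Coopposite

variable {K : Type*} {C : Type*} [Field K] [AddCommGroup C] [Module K C]

instance : AddCommGroup (Coopposite C) := inferInstanceAs (AddCommGroup C)

instance : Module K (Coopposite C) := inferInstanceAs (Module K C)

variable {M N : Type*} [AddCommGroup M] [Module K M] [AddCommGroup N] [Module K N]

/-- Right `C`-coactions as left coactions of the coopposite coalgebra. -/
noncomputable def coactionEquiv (K C M : Type*) [Field K] [AddCommGroup C] [Module K C]
    [AddCommGroup M] [Module K M] :
    (M →ₗ[K] M ⊗[K] C) ≃ (M →ₗ[K] Coopposite C ⊗[K] M) where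
  toFun ρ := (TensorProduct.comm K M C).toLinearMap ∘ₗ ρ
  invFun σ := (TensorProduct.comm K M C).symm.toLinearMap ∘ₗ σ
  left_inv ρ := LinearMap.ext fun x => (TensorProduct.comm K M C).symm_apply_apply (ρ x)
  right_inv σ := LinearMap.ext fun x => (TensorProduct.comm K M C).apply_symm_apply (σ x)

theorem isLeftComoduleHom_iff {ρ : M →ₗ[K] M ⊗[K] C} {σ : N →ₗ[K] N ⊗[K] C} {f : M →ₗ[K] N} :
    IsLeftComoduleHom (coactionEquiv K C M ρ) (coactionEquiv K C N σ) f ↔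
      IsRightComoduleHom ρ σ f := by
  have h : f.lTensor C ∘ₗ (TensorProduct.comm K M C).toLinearMap ∘ₗ ρ =
      (TensorProduct.comm K N C).toLinearMap ∘ₗ f.rTensor C ∘ₗ ρ :=
    LinearMap.ext fun x => LinearMap.lTensor_comm _ _
  rw [IsRightComoduleHom, ← LinearMap.cancel_left (TensorProduct.comm K N C).injective]
  exact Eq.congr_right h

theorem isLeftSubcomodule_iff {ρ : M →ₗ[K] M ⊗[K] C} {P : Submodule K M} :
    IsLeftSubcomodule (coactionEquiv K C M ρ) P ↔ IsRightSubcomodule ρ P := by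
  refine forall₂_congr fun x _ => ?_
  change TensorProduct.comm K M C (ρ x) ∈ LinearMap.range (P.subtype.lTensor C) ↔ _
  constructor
  · rintro ⟨t, ht⟩
    refine ⟨(TensorProduct.comm K P C).symm t, (TensorProduct.comm K M C).injective ?_⟩
    rw [← ht, ← LinearMap.lTensor_comm, LinearEquiv.apply_symm_apply]
  · rintro ⟨t, ht⟩
    exact ⟨TensorProduct.comm K P C t, by rw [← ht, LinearMap.lTensor_comm]⟩

variable [Coalgebra K C]

noncomputable instance : Coalgebra K (Coopposite C) where
  comul := (TensorProduct.comm K C C).toLinearMap ∘ₗ (Coalgebra.comul (R := K) (A := C))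
  counit := Coalgebra.counit (R := K) (A := C)
  coassoc := by
    have h1 := congrArg (· ∘ₗ Coalgebra.comul) (assoc_comp_rTensor_comm_comp_comm (M := C)
      (Coalgebra.comul (R := K) (A := C)))
    have h2 := congrArg (· ∘ₗ Coalgebra.comul) (lTensor_comm_comp_comm
      (Coalgebra.comul (R := K) (A := C)))
    exact h1.trans (.trans (congrArg ((tensorReverse K C C).toLinearMap ∘ₗ ·)
      Coalgebra.coassoc.symm) h2.symm)
  rTensor_counit_comp_comul := by
    change (Coalgebra.counit (R := K) (A := C)).rTensor C ∘ₗ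
      (TensorProduct.comm K C C).toLinearMap ∘ₗ Coalgebra.comul = TensorProduct.mk K K C 1
    ext c
    simp only [LinearMap.comp_apply, LinearEquiv.coe_coe, LinearMap.rTensor_comm]
    simp
  lTensor_counit_comp_comul := by
    change (Coalgebra.counit (R := K) (A := C)).lTensor C ∘ₗ
      (TensorProduct.comm K C C).toLinearMap ∘ₗ Coalgebra.comul = (TensorProduct.mk K C K).flip 1
    ext c
    simp only [LinearMap.comp_apply, LinearEquiv.coe_coe, LinearMap.lTensor_comm]
    simp

theorem isLeftCoaction_iff {ρ : M →ₗ[K] M ⊗[K] C} :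
    IsLeftCoaction (coactionEquiv K C M ρ) ↔ IsRightCoaction ρ := by
  have h1 := congrArg (· ∘ₗ ρ) (assoc_comp_rTensor_comm_comp_comm (M := M)
      (Coalgebra.comul (R := K) (A := C)))
  have h2 := congrArg (· ∘ₗ ρ) (lTensor_comm_comp_comm ρ)
  have h3 : ∀ t : M ⊗[K] C, TensorProduct.lid K M ((Coalgebra.counit (R := K) (A := C)).rTensor M
      (TensorProduct.comm K M C t)) = TensorProduct.rid K M
        ((Coalgebra.counit (R := K) (A := C)).lTensor M t) := by
    intro t
    induction t with
    | zero => simp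
    | tmul a b => simp
    | add a b ha hb => simp_all
  constructor
  · rintro ⟨ha, hc⟩
    refine ⟨?_, ?_⟩
    · rw [← LinearMap.cancel_left (tensorReverse K C M).injective]
      exact h2.symm.trans (ha.symm.trans h1)
    · exact LinearMap.ext fun x => (h3 (ρ x)).symm.trans (LinearMap.congr_fun hc x)
  · rintro ⟨ha, hc⟩
    refine ⟨?_, ?_⟩
    · exact h1.trans (.trans (congrArg ((tensorReverse K C M).toLinearMap ∘ₗ ·) ha.symm) h2.symm)
    · exact LinearMap.ext fun x => (h3 (ρ x)).trans (LinearMap.congr_fun hc x)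

end Coopposite

/-- The coopposite of a left semiperfect coalgebra is right semiperfect. -/
theorem IsLeftSemiperfect.coopposite {K : Type u} [Field K] {C : Type v} [AddCommGroup C]
    [Module K C] [Coalgebra K C] (h : IsLeftSemiperfect K C) :
    IsRightSemiperfect K (Coopposite C) := by
  intro M _ _ ρ hρ hinj hind
  obtain ⟨ρ, rfl⟩ := (Coopposite.coactionEquiv K C M).surjective ρ
  refine h M ρ (Coopposite.isLeftCoaction_iff.1 hρ) ?_ ?_
  · intro X Y _ _ _ _ ρX ρY hX hY i f hi hii hf
    obtain ⟨g, hg, hgi⟩ := hinj X Y _ _ (Coopposite.isLeftCoaction_iff.2 hX)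
      (Coopposite.isLeftCoaction_iff.2 hY) i f (Coopposite.isLeftComoduleHom_iff.2 hi) hii
      (Coopposite.isLeftComoduleHom_iff.2 hf)
    exact ⟨g, Coopposite.isLeftComoduleHom_iff.1 hg, hgi⟩
  · exact ⟨hind.1, fun N P hN hP => hind.2 N P (Coopposite.isLeftSubcomodule_iff.2 hN)
      (Coopposite.isLeftSubcomodule_iff.2 hP)⟩

/-- Over a left semiperfect coalgebra, every finite dimensional subspace of `C` lies in a finite
dimensional direct summand of the right comodule `C`. -/
theorem IsLeftSemiperfect.exists_finiteDimensional_retract {K : Type u} [Field K] {C : Type v}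
    [AddCommGroup C] [Module K C] [Coalgebra K C] (h : IsLeftSemiperfect K C) (T : Finset C) :
    ∃ (P : Submodule K C) (r : C →ₗ[K] C), FiniteDimensional K P ∧ ↑T ⊆ (P : Set C) ∧
      IsRightComoduleHom (Coalgebra.comul (R := K) (A := C)) Coalgebra.comul r ∧
      (∀ x, r x ∈ P) ∧ ∀ x ∈ P, r x = x := by
  obtain ⟨P, r, hP, hT, hr, hrP, hid⟩ := h.coopposite.exists_finiteDimensional_retract T
  exact ⟨P, r, hP, hT, Coopposite.isLeftComoduleHom_iff.1 hr, hrP, hid⟩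

/-! ## The idempotents of a decomposition -/

section DualAlgebra

variable {K C : Type*} [Field K] [AddCommGroup C] [Module K C] [Coalgebra K C]

theorem dualMul_apply_eq_leftCoinduced (g f : DualAlgebra K C) (c : C) :
    (g * f) c = g (leftCoinduced Coalgebra.comul f.ofConv c) := by
  rw [LinearMap.convMul_apply]
  change _ = g.ofConv (TensorProduct.rid K C (f.ofConv.lTensor C (Coalgebra.comul c)))
  generalize Coalgebra.comul (R := K) c = t
  induction t with
  | zero => simp
  | tmul a b => simp [mul_comm]
  | add a b ha hb => simp_all

/-- As Δ(P) ⊆ C ⊗ P, the right factor of a product is evaluated only on P. -/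
theorem dualMul_apply_congr {P : Submodule K C}
    (hP : IsLeftSubcomodule (Coalgebra.comul (R := K) (A := C)) P) (g : DualAlgebra K C)
    {e e' : DualAlgebra K C} (h : ∀ x ∈ P, e x = e' x) {c : C} (hc : c ∈ P) :
    (g * e) c = (g * e') c := by
  obtain ⟨t, ht⟩ := hP c hc
  rw [LinearMap.convMul_apply, LinearMap.convMul_apply, ← ht]
  clear ht
  induction t with
  | zero => simp
  | tmul a b =>
    have : e.ofConv b = e'.ofConv b := h b b.2
    simp [this]
  | add a b ha hb => simp_all

theorem comp_dualMul_apply {r : C →ₗ[K] C}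
    (hr : IsRightComoduleHom (Coalgebra.comul (R := K) (A := C)) Coalgebra.comul r)
    (g f : DualAlgebra K C) (c : C) :
    ((WithConv.toConv (g.ofConv ∘ₗ r) : DualAlgebra K C) * f) c = (g * f) (r c) := by
  rw [LinearMap.convMul_apply, LinearMap.convMul_apply,
    show Coalgebra.comul (r c) = r.rTensor C (Coalgebra.comul (R := K) c) from
      LinearMap.congr_fun hr c]
  generalize Coalgebra.comul (R := K) c = t
  induction t with
  | zero => simp
  | tmul a b => simp
  | add a b ha hb => simp_all

/-- R is a left ideal of C^*: in (ga)f = ∑ (ga)(cᵢ) mᵢ the coefficient (ga)(cᵢ) is g evaluated at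
the element obtained from cᵢ by applying a to its second leg. -/
theorem mul_mem_leftRat (a : DualAlgebra K C) {f : DualAlgebra K C} (hf : f ∈ leftRat K C) :
    a * f ∈ leftRat K C := by
  obtain ⟨n, c, m, h⟩ := hf
  refine ⟨n, fun i => leftCoinduced Coalgebra.comul a.ofConv (c i), m, fun g => ?_⟩
  rw [← mul_assoc, h]
  exact Finset.sum_congr rfl fun i _ => by rw [dualMul_apply_eq_leftCoinduced]

end DualAlgebra

namespace IsLeftInjectiveDecomposition

variable {K : Type*} {C : Type*} [Field K] [AddCommGroup C] [Module K C] [Coalgebra K C]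
  {J : Type*} {E : J → Submodule K C} (h : IsLeftInjectiveDecomposition E)

/-- The projection of `C` onto the `j`-th summand. -/
noncomputable def proj (j : J) : C →ₗ[K] C :=
  (E j).subtype ∘ₗ (E j).projectionOnto (⨆ (p) (_ : p ≠ j), E p) (h.isCompl j)

theorem proj_mem (j : J) (x : C) : h.proj j x ∈ E j := Subtype.prop _

theorem proj_of_mem {j : J} {x : C} (hx : x ∈ E j) : h.proj j x = x :=
  congrArg Subtype.val (Submodule.projectionOnto_apply_of_mem_left (h.isCompl j) hx)

theorem proj_of_mem_of_ne {j p : J} (hpj : p ≠ j) {x : C} (hx : x ∈ E p) : h.proj j x = 0 :=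
  congrArg Subtype.val ((Submodule.projectionOnto_apply_eq_zero_iff (h.isCompl j)).2
    (Submodule.mem_iSup_of_mem p (Submodule.mem_iSup_of_mem hpj hx)))

include h in
theorem linearMap_ext {M : Type*} [AddCommGroup M] [Module K M] {f g : C →ₗ[K] M}
    (hfg : ∀ j, ∀ x ∈ E j, f x = g x) : f = g := by
  have : ⨆ j, E j ≤ LinearMap.eqLocus f g := iSup_le fun j x hx => hfg j x hx
  rw [h.iSup_eq_top] at this
  exact LinearMap.ext fun x => this trivial

theorem idem_apply (j : J) (c : C) :
    h.idem j c = Coalgebra.counit (R := K) (h.proj j c) := rfl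

/-- On a summand E_p the factor e_j acts through its restriction to E_p, which is that of the unit ε
if p = j and zero otherwise. -/
theorem mul_idem (g : DualAlgebra K C) (j : J) :
    g * h.idem j = WithConv.toConv (g.ofConv ∘ₗ h.proj j) := by
  apply WithConv.ofConv_injective
  refine h.linearMap_ext fun p x hx => ?_
  change (g * h.idem j) x = g (h.proj j x)
  by_cases hpj : p = j
  · subst hpj
    rw [h.proj_of_mem hx, dualMul_apply_congr (h.subcomodule p) g (e' := 1) _ hx, mul_one]
    intro y hy
    rw [idem_apply, h.proj_of_mem hy]
    rfl
  · rw [h.proj_of_mem_of_ne hpj hx, dualMul_apply_congr (h.subcomodule p) g (e' := 0) _ hx,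
      mul_zero]
    · exact (map_zero g.ofConv).symm
    · intro y hy
      rw [idem_apply, h.proj_of_mem_of_ne hpj hy, map_zero]
      rfl

theorem mul_idem_apply (g : DualAlgebra K C) (j : J) (c : C) :
    (g * h.idem j) c = g (h.proj j c) := by rw [mul_idem]; rfl

theorem idem_mul_self (j : J) : h.idem j * h.idem j = h.idem j := by
  apply WithConv.ofConv_injective
  refine LinearMap.ext fun x => ?_
  refine (h.mul_idem_apply _ j x).trans ?_
  rw [idem_apply, h.proj_of_mem (h.proj_mem j x)]
  rfl

theorem idem_mul_of_ne {i j : J} (hij : i ≠ j) : h.idem i * h.idem j = 0 := by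
  apply WithConv.ofConv_injective
  refine LinearMap.ext fun x => ?_
  refine (h.mul_idem_apply _ j x).trans ?_
  rw [idem_apply, h.proj_of_mem_of_ne hij.symm (h.proj_mem j x), map_zero]
  rfl

/-- Expanding the projection in a finite basis of E_j turns g e_j = g ∘ proj_j into the finite sum
required by rationality. -/
theorem idem_mem_leftRat (hfin : ∀ j, FiniteDimensional K (E j)) (j : J) :
    h.idem j ∈ leftRat K C := by
  have := hfin j
  let B := Module.finBasis K (E j)
  refine ⟨_, fun i => B i, fun i => WithConv.toConv (B.coord i ∘ₗ
    (E j).projectionOnto (⨆ (p) (_ : p ≠ j), E p) (h.isCompl j)), fun g => ?_⟩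
  apply WithConv.ofConv_injective
  refine LinearMap.ext fun x => ?_
  refine (h.mul_idem_apply g j x).trans ?_
  rw [proj, LinearMap.comp_apply]
  conv_lhs => rw [← B.sum_repr ((E j).projectionOnto _ (h.isCompl j) x)]
  rw [map_sum]
  change g.ofConv _ = _
  rw [map_sum, WithConv.ofConv_sum, LinearMap.sum_apply]
  refine Finset.sum_congr rfl fun i _ => ?_
  rw [map_smul, map_smul, smul_eq_mul, mul_comm]
  rfl

theorem sum_proj_eq {F : Finset J} {c : C} (hc : c ∈ ⨆ j ∈ F, E j) :
    ∑ j ∈ F, h.proj j c = c := by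
  classical
  have : ⨆ j ∈ F, E j ≤ LinearMap.eqLocus (∑ j ∈ F, h.proj j) LinearMap.id := by
    refine iSup₂_le fun p hp x hx => ?_
    change (∑ j ∈ F, h.proj j) x = x
    rw [LinearMap.sum_apply, Finset.sum_eq_single_of_mem p hp, h.proj_of_mem hx]
    exact fun j _ hj => h.proj_of_mem_of_ne hj.symm hx
  simpa using this hc

theorem proj_eq_zero {F : Finset J} {c : C} (hc : c ∈ ⨆ j ∈ F, E j) {j : J} (hj : j ∉ F) :
    h.proj j c = 0 := by
  have : ⨆ p ∈ F, E p ≤ LinearMap.ker (h.proj j) :=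
    iSup₂_le fun p hp x hx => h.proj_of_mem_of_ne (by rintro rfl; exact hj hp) hx
  exact this hc

include h in
theorem exists_finset_mem (c : C) : ∃ F : Finset J, c ∈ ⨆ j ∈ F, E j :=
  Submodule.mem_iSup_iff_exists_finset.1 (h.iSup_eq_top ▸ Submodule.mem_top)

include h in
theorem exists_finset_subset (T : Finset C) :
    ∃ F : Finset J, ∀ c ∈ T, c ∈ ⨆ j ∈ F, E j := by
  classical
  choose F hF using h.exists_finset_mem
  refine ⟨T.biUnion F, fun c hc => ?_⟩
  have hle : ⨆ j ∈ F c, E j ≤ ⨆ j ∈ T.biUnion F, E j :=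
    biSup_mono fun j hj => Finset.mem_biUnion.2 ⟨c, hc, hj⟩
  exact hle (hF c)

theorem sum_idem_apply {F : Finset J} {c : C} (hc : c ∈ ⨆ j ∈ F, E j) :
    (∑ j ∈ F, h.idem j) c = Coalgebra.counit (R := K) c := by
  conv_rhs => rw [← h.sum_proj_eq hc, map_sum]
  change (∑ j ∈ F, h.idem j).ofConv c = _
  rw [WithConv.ofConv_sum, LinearMap.sum_apply]
  rfl

end IsLeftInjectiveDecomposition

/-- An ideal of finite codimension contains almost all members of a family of orthogonal
idempotents. -/
theorem IsCofiniteIdeal.finite_setOf_notMem {K A J : Type*} [Field K] [NonUnitalRing A]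
    [Module K A] [SMulCommClass K A A] {I : Submodule K A} (hI : IsCofiniteIdeal I) {e : J → A}
    (hself : ∀ j, e j * e j = e j) (hne : ∀ i j, i ≠ j → e i * e j = 0) :
    {j | e j ∉ I}.Finite := by
  have := hI.finite
  have hlin : LinearIndependent K fun j : {j | e j ∉ I} => I.mkQ (e j) := by
    rw [linearIndependent_iff']
    intro s a hs k hk
    have hsum : ∑ i ∈ s, a i • e i ∈ I := by
      rw [← Submodule.Quotient.mk_eq_zero, ← Submodule.mkQ_apply, map_sum, ← hs]
      simp only [map_smul]
    -- Multiplying a relation modulo I by e_k isolates a_k e_k.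
    have hmem := hI.mul_left (e k) _ hsum
    have hcalc : e k * ∑ i ∈ s, a i • e i = a k • e k := by
      rw [Finset.mul_sum, Finset.sum_eq_single_of_mem k hk]
      · rw [mul_smul_comm, hself]
      · intro i _ hik
        rw [mul_smul_comm, hne _ _ fun hki => hik (Subtype.ext hki.symm), smul_zero]
    rw [hcalc] at hmem
    by_contra hak
    exact k.2 ((Submodule.smul_mem_iff I hak).1 hmem)
  have := hlin.finite
  exact Set.toFinite _

/-! ### Local units in R and bijectivity of φ_l -/

section Local

variable {K : Type u} [Field K] {C : Type v} [AddCommGroup C] [Module K C] [Coalgebra K C]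
  {J : Type*} {E : J → Submodule K C}

/-- Over a left semiperfect coalgebra, the rational functionals are fixed by right multiplication
by a finite sum of the idempotents `eⱼ`. -/
theorem IsLeftInjectiveDecomposition.exists_mul_sum_idem (h : IsLeftInjectiveDecomposition E)
    (hl : IsLeftSemiperfect K C) {r : DualAlgebra K C} (hr : r ∈ leftRat K C) :
    ∃ F : Finset J, r * ∑ j ∈ F, h.idem j = r := by
  classical
  obtain ⟨n, c, m, hrat⟩ := hr
  obtain ⟨P, π, hPfin, hcP, hπ, hπP, hπid⟩ :=
    hl.exists_finiteDimensional_retract (Finset.univ.image c)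
  -- The product gr depends only on the values g(cᵢ), and π fixes every cᵢ. Since π is a right
  -- comodule map, r therefore factors through π.
  have hunit : (WithConv.toConv ((1 : DualAlgebra K C).ofConv ∘ₗ π) : DualAlgebra K C) * r = r := by
    conv_rhs => rw [← one_mul r, hrat]
    rw [hrat]
    refine Finset.sum_congr rfl fun i _ => ?_
    have hi : π (c i) = c i := hπid _ (hcP (by simp))
    change (1 : DualAlgebra K C).ofConv (π (c i)) • m i = (1 : DualAlgebra K C).ofConv (c i) • m i
    rw [hi]
  have hrπ : r.ofConv ∘ₗ π = r.ofConv := LinearMap.ext fun x => by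
    have := comp_dualMul_apply hπ 1 r x
    rw [hunit, one_mul] at this
    exact this.symm
  have hmul : ∀ e x, (r * e) x = (r * e) (π x) := fun e x => by
    have := comp_dualMul_apply hπ r e x
    rwa [hrπ] at this
  obtain ⟨S, hS⟩ := (Module.Finite.iff_fg.1 hPfin : P.FG)
  let R := fun s : C => Coalgebra.Repr.arbitrary K s
  -- Both re and r factor through π, so they need only be compared on a finite spanning set of P.
  -- There e enters only through its values on finitely many right legs, where a finite sum of e_j
  -- equals ε.
  obtain ⟨F, hF⟩ := h.exists_finset_subset (S.biUnion fun s => (R s).index.image (R s).right)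
  refine ⟨F, ?_⟩
  have hle : P ≤ LinearMap.eqLocus (r * ∑ j ∈ F, h.idem j).ofConv (r * 1).ofConv := by
    rw [← hS, Submodule.span_le]
    intro s hs
    change (r * ∑ j ∈ F, h.idem j) s = (r * 1) s
    rw [(R s).convMul_apply, (R s).convMul_apply]
    refine Finset.sum_congr rfl fun i hi => ?_
    rw [h.sum_idem_apply (hF _ (Finset.mem_biUnion.2 ⟨s, hs, Finset.mem_image_of_mem _ hi⟩))]
    rfl
  apply WithConv.ofConv_injective
  refine LinearMap.ext fun x => ?_
  refine (hmul _ x).trans ((hle (hπP x)).trans ((hmul 1 x).symm.trans ?_))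
  rw [mul_one]

/-- The canonical map `C → R⁰` is injective. -/
theorem IsLeftInjectiveDecomposition.phiLeft_injective (h : IsLeftInjectiveDecomposition E)
    (he : ∀ j, h.idem j ∈ leftRat K C) : Function.Injective (phiLeft K C) := by
  rw [injective_iff_map_eq_zero]
  intro c hc
  obtain ⟨F, hF⟩ := h.exists_finset_mem c
  rw [← h.sum_proj_eq hF]
  refine Finset.sum_eq_zero fun j _ => ?_
  -- Every φ e_j lies in R, and its value at c is φ(proj_j c).
  rw [← Module.forall_dual_apply_eq_zero_iff K]
  intro φ
  have := LinearMap.congr_fun (congrArg Subtype.val hc)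
    ⟨WithConv.toConv φ * h.idem j, mul_mem_leftRat _ (he j)⟩
  exact (h.mul_idem_apply _ j c).symm.trans this

/-- The canonical map `C → R⁰` is surjective. -/
theorem IsLeftInjectiveDecomposition.phiLeft_surjective (h : IsLeftInjectiveDecomposition E)
    (hl : IsLeftSemiperfect K C) (hfin : ∀ j, FiniteDimensional K (E j)) :
    Function.Surjective (phiLeft K C) := by
  classical
  have he := h.idem_mem_leftRat hfin
  rintro ⟨f, I, hI, hf⟩
  have hc : ∀ j, ∃ c : C, ∀ φ : DualAlgebra K C,
      f ⟨φ * h.idem j, mul_mem_leftRat φ (he j)⟩ = φ c := by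
    intro j
    have := hfin j
    let π := (E j).projectionOnto (⨆ (p) (_ : p ≠ j), E p) (h.isCompl j)
    -- f restricted to C^* e_j ≅ E_j^* is an element of the bidual of E_j, hence evaluation at a
    -- vector.
    let L : Module.Dual K (Module.Dual K (E j)) :=
      { toFun := fun ψ => f ⟨WithConv.toConv (ψ ∘ₗ π) * h.idem j, mul_mem_leftRat _ (he j)⟩
        map_add' := fun ψ ψ' => by
          rw [← map_add]
          exact congrArg f (Subtype.ext (add_mul (WithConv.toConv (ψ ∘ₗ π) : DualAlgebra K C)
            (WithConv.toConv (ψ' ∘ₗ π)) (h.idem j)))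
        map_smul' := fun a ψ => by
          rw [← map_smul]
          exact congrArg f (Subtype.ext (smul_mul_assoc a
            (WithConv.toConv (ψ ∘ₗ π) : DualAlgebra K C) (h.idem j))) }
    obtain ⟨c, hc⟩ := (Module.evalEquiv K (E j)).surjective L
    refine ⟨c, fun φ => ?_⟩
    refine Eq.trans ?_ (LinearMap.congr_fun hc (φ.ofConv ∘ₗ (E j).subtype)).symm
    refine congrArg f (Subtype.ext (WithConv.ofConv_injective (LinearMap.ext fun x => ?_)))
    refine (h.mul_idem_apply φ j x).trans (.trans ?_ (h.mul_idem_apply _ j x).symm)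
    exact congrArg φ.ofConv (h.proj_of_mem (h.proj_mem j x)).symm
  choose c hc using hc
  have hF := hI.finite_setOf_notMem (e := fun j => (⟨h.idem j, he j⟩ : leftRat K C))
    (fun j => Subtype.ext (h.idem_mul_self j)) fun i j hij => Subtype.ext (h.idem_mul_of_ne hij)
  have hzero : ∀ j ∉ hF.toFinset, ∀ φ : DualAlgebra K C, φ (c j) = 0 := by
    intro j hj φ
    have hj' : (⟨h.idem j, he j⟩ : leftRat K C) ∈ I := by simpa using hj
    rw [← hc]
    refine hf ?_
    -- I is an ideal of R only, and φ need not lie in R; writing φ e_j = (φ e_j) e_j makes the left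
    -- factor an element of R.
    have := hI.mul_left ⟨φ * h.idem j, mul_mem_leftRat φ (he j)⟩ _ hj'
    convert this using 1
    refine Subtype.ext ?_
    change φ * h.idem j = φ * h.idem j * h.idem j
    rw [mul_assoc, h.idem_mul_self]
  refine ⟨∑ j ∈ hF.toFinset, c j, Subtype.ext (LinearMap.ext fun r => ?_)⟩
  obtain ⟨F, hr⟩ := h.exists_mul_sum_idem hl r.2
  have hrsum : r = ∑ j ∈ F, ⟨r.1 * h.idem j, mul_mem_leftRat r.1 (he j)⟩ := by
    refine Subtype.ext ?_
    rw [AddSubmonoidClass.coe_finsetSum, ← Finset.mul_sum, hr]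
  change r.1.ofConv (∑ j ∈ hF.toFinset, c j) = f r
  conv_rhs => rw [hrsum, map_sum]
  simp only [hc]
  rw [map_sum]
  -- The two index sets may differ, but r(c_j) = f(r e_j) vanishes outside either: outside F because
  -- r e_j = 0, outside the other because e_j ∈ I.
  refine Finset.sum_congr_of_eq_on_inter (fun j _ hj => ?_) (fun j _ hj => hzero j hj r.1)
    fun _ _ _ => rfl
  rw [← hc, show (⟨r.1 * h.idem j, mul_mem_leftRat r.1 (he j)⟩ : leftRat K C) = 0 from
    Subtype.ext ?_, map_zero]
  change r.1 * h.idem j = 0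
  rw [← hr, mul_assoc, Finset.sum_mul, Finset.sum_eq_zero, mul_zero]
  intro i hi
  exact h.idem_mul_of_ne (by rintro rfl; exact hj hi)

end Local

/-! ### Compatibility with the comultiplications, and the counit -/

section Counit

variable {K : Type u} [Field K] {C : Type v} [AddCommGroup C] [Module K C] [Coalgebra K C]

theorem finiteDualPairing_map_phiLeft (t : C ⊗[K] C) (a b : leftRat K C) :
    finiteDualPairing K (leftRat K C) (TensorProduct.map (phiLeft K C) (phiLeft K C) t) a b =
      LinearMap.mul' K K (TensorProduct.map a.1.ofConv b.1.ofConv t) := by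
  induction t with
  | zero => simp
  | tmul c d => rfl
  | add x y hx hy => simp_all

/-- Paired with a, b ∈ R, both sides give (ab)(c), by the definition of convolution; the pairing is
injective. -/
theorem map_phiLeft_comul (c : C) :
    TensorProduct.map (phiLeft K C) (phiLeft K C) (Coalgebra.comul c) =
      finiteDualComul K (leftRat K C) (phiLeft K C c) := by
  refine finiteDualPairing_injective K _ (funext₂ fun (a b : leftRat K C) => ?_)
  rw [finiteDualPairing_map_phiLeft, finiteDualPairing_comul]
  rfl

end Counit

theorem mainTheorem2 {K : Type u} {C : Type v} [Field K] [AddCommGroup C] [Module K C]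
    [Coalgebra K C] (hl : IsLeftSemiperfect K C) (hr : IsRightSemiperfect K C) :
    IsLeftCoreflexive K C ∧
    (∃ (J : Type v) (E : J → Submodule K C), IsLeftInjectiveDecomposition E) ∧
    ∃ inst : Coalgebra K (finiteDual K (leftRat K C)),
      inst.comul = finiteDualComul K (leftRat K C) ∧
      (∀ (J : Type v) (E : J → Submodule K C) (hE : IsLeftInjectiveDecomposition E),
        ∃ he : ∀ j, hE.idem j ∈ leftRat K C, ∀ f : finiteDual K (leftRat K C),
          {j | f.1 ⟨hE.idem j, he j⟩ ≠ 0}.Finite ∧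
          inst.counit f = ∑ᶠ j, f.1 ⟨hE.idem j, he j⟩) ∧
      ∃ Φ : C ≃ₗc[K] finiteDual K (leftRat K C), ∀ c : C, Φ c = phiLeft K C c := by
  have hdec := exists_isLeftInjectiveDecomposition K C
  have hbij : IsLeftCoreflexive K C := by
    obtain ⟨J, E, hE⟩ := hdec
    exact ⟨hE.phiLeft_injective (hE.idem_mem_leftRat (hE.finiteDimensional hr)),
      hE.phiLeft_surjective hl (hE.finiteDimensional hr)⟩
  let Φ := LinearEquiv.ofBijective (phiLeft K C) hbij
  let _ : CoalgebraStruct K (finiteDual K (leftRat K C)) :=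
    { comul := finiteDualComul K (leftRat K C)
      -- This choice is forced by Φ preserving counits. The coalgebra axioms are transported along Ψ
      -- below.
      counit := Coalgebra.counit ∘ₗ Φ.symm.toLinearMap }
  let Ψ : C ≃ₗc[K] finiteDual K (leftRat K C) :=
    { Φ with
      counit_comp := LinearMap.ext fun c => congrArg Coalgebra.counit (Φ.symm_apply_apply c)
      map_comp_comul := LinearMap.ext map_phiLeft_comul }
  refine ⟨hbij, hdec, Ψ.toCoalgebra, rfl, fun J E hE => ?_, Ψ, fun c => rfl⟩
  have he := hE.idem_mem_leftRat (hE.finiteDimensional hr)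
  refine ⟨he, fun f => ?_⟩
  obtain ⟨c, rfl⟩ := Φ.surjective f
  obtain ⟨F, hF⟩ := hE.exists_finset_mem c
  -- f(e_j) = ε(proj_j c), which vanishes unless E_j is among the finitely many summands whose sum
  -- contains c.
  have hsupp : (Function.support fun j => (Φ c).1 ⟨hE.idem j, he j⟩) ⊆ F := by
    intro j hj
    by_contra hjF
    refine hj ?_
    change Coalgebra.counit (R := K) (hE.proj j c) = 0
    rw [hE.proj_eq_zero hF hjF, map_zero]
  refine ⟨F.finite_toSet.subset hsupp, ?_⟩
  rw [finsum_eq_sum_of_support_subset _ hsupp]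
  change Coalgebra.counit (R := K) (Φ.symm (Φ c)) =
    ∑ j ∈ F, Coalgebra.counit (R := K) (hE.proj j c)
  rw [Φ.symm_apply_apply, ← map_sum, hE.sum_proj_eq hF]
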